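/- Let $T>0$ and let $g_0,g_1\in C_c^\infty(\mathbb{R})$ be (complex- or real-valued) functions. Let $H$ be the Heaviside function, $H(t)=1$ for $t\ge 0$ and $H(t)=0$ for $t<0$, and consider the Cauchy problem $$\partial_t^2u(t,x)-H(t-1)\,\partial_x^2u(t,x)=0,\quad t\in[0,T],\ x\in\mathbb{R},\qquad u(0,x)=g_0(x),\quad \partial_tu(0,x)=g_1(x). \tag{1}$$ A very weak solution of (1) is a net $(u_\varepsilon)_{\varepsilon\in(0,1]}$ of functions $u_\varepsilon\in C^\infty([0,T]\times\mathbb{R})$ for which there are a mollifier $\varphi\in C_c^\infty(\mathbb{R})$ with $\varphi\ge 0$, $\int\varphi=1$, and a scale $\kappa:(0,1]\to(0,\infty)$ with $\kappa(\varepsilon)\to0$ as $\varepsilon\to0$ (for instance $\kappa(\varepsilon)=\varepsilon$), such that for every $\varepsilon\in(0,1]$ $$\partial_t^2u_\varepsilon(t,x)-H_\varepsilon(t-1)\,\partial_x^2u_\varepsilon(t,x)=0,\quad t\in[0,T],\ x\in\mathbb{R},\qquad u_\varepsilon(0,x)=g_0(x),\quad \partial_tu_\varepsilon(0,x)=g_1(x),$$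 where $H_\varepsilon=H*\varphi_{\kappa(\varepsilon)}$ and $\varphi_{\eta}(t)=\eta^{-1}\varphi(t/\eta)$. The piecewise distributional solution $\bar u$ of (1) is $$\bar u(t,x)=g_0(x)+t\,g_1(x)\quad\text{for } t<1,$$ $$\bar u(t,x)=\tfrac12\big(g_1(x+t-1)+g_1(x-t+1)+g_0(x+t-1)+g_0(x-t+1)\big)+\tfrac12\int_{x-t+1}^{x+t-1}g_1(s)\,ds\quad\text{for } t\ge1.$$ Then for every very weak solution $(u_\varepsilon)_\varepsilon$ of (1), the functions $u_\varepsilon$ and $\bar u$ belong to $C^1([0,T];L^2(\mathbb{R}))$, and $u_\varepsilon\to\bar u$ in $C^1([0,T];L^2(\mathbb{R}))$ as $\varepsilon\to0$, that is, $$\sup_{t\in[0,T]}\|u_\varepsilon(t,\cdot)-\bar u(t,\cdot)\|_{L^2(\mathbb{R})}+\sup_{t\in[0,T]}\|\partial_tu_\varepsilon(t,\cdot)-\partial_t\bar u(t,\cdot)\|_{L^2(\mathbb{R})}\to0 .$$ -/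

import Mathlib

open Set Filter Topology MeasureTheory
open scoped ContDiff

noncomputable section

namespace HeavisideWave

/-- The Heaviside function, `H t = 1` for `t ≥ 0` and `H t = 0` for `t < 0`. -/
def heaviside (t : ℝ) : ℝ := if 0 ≤ t then 1 else 0

/-- `φ` is a nonnegative Friedrichs mollifier: `φ ∈ C_c^∞(ℝ)`, `φ ≥ 0`, `∫ φ = 1`. -/
structure IsMollifier (φ : ℝ → ℝ) : Prop where
  smooth : ContDiff ℝ ∞ φ
  compact : HasCompactSupport φ
  nonneg : ∀ t, 0 ≤ φ t
  integral_eq_one : ∫ t, φ t = 1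

/-- The rescaled mollifier `φ_η(t) = η⁻¹ φ(t / η)`. -/
def rescale (φ : ℝ → ℝ) (η : ℝ) (t : ℝ) : ℝ := η⁻¹ * φ (t / η)

/-- The regularised Heaviside function `H ∗ φ_η`. -/
def regHeaviside (φ : ℝ → ℝ) (η : ℝ) : ℝ → ℝ :=
  convolution heaviside (rescale φ η) (ContinuousLinearMap.lsmul ℝ ℝ) volume

/-- A regularisation scale: `κ(ε) > 0` for `ε ∈ (0,1]` and `κ(ε) → 0` as `ε → 0⁺`. -/
structure IsScale (κ : ℝ → ℝ) : Prop where
  pos : ∀ ε ∈ Ioc (0 : ℝ) 1, 0 < κ ε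
  tendsto : Tendsto κ (𝓝[>] 0) (𝓝 0)

/-- `u` (with arguments time, space) is a smooth solution on `[0,T] × ℝ` of
`u_tt - a(t) u_xx = 0`, `u(0,x) = g₀(x)`, `u_t(0,x) = g₁(x)`.
Time derivatives are taken in `[0,T]`, so they are one-sided at the end points. -/
structure IsSmoothSolution (T : ℝ) (a : ℝ → ℝ) (g₀ g₁ : ℝ → ℂ) (u : ℝ → ℝ → ℂ) : Prop where
  smooth : ContDiffOn ℝ ∞ (fun p : ℝ × ℝ => u p.1 p.2) (Icc 0 T ×ˢ univ)
  equation : ∀ t ∈ Icc 0 T, ∀ x : ℝ,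
    iteratedDerivWithin 2 (fun s => u s x) (Icc 0 T) t
      - (a t : ℂ) * iteratedDeriv 2 (fun y => u t y) x = 0
  initial : ∀ x, u 0 x = g₀ x
  initial_deriv : ∀ x, derivWithin (fun s => u s x) (Icc 0 T) 0 = g₁ x

/-- The net `(u ε)`, `ε ∈ (0,1]`, is a very weak solution of
`u_tt - H(t-1) u_xx = 0`, `u(0,·) = g₀`, `u_t(0,·) = g₁`: for some mollifier `φ` and some
scale `κ`, each `u ε` is a smooth solution of the problem in which `H` is replaced by
`H ∗ φ_{κ(ε)}`. The smooth data are not regularised. No moderateness (polynomial growth in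
`1/ε` of the derivatives) is asked of the net, which makes the notion more inclusive. -/
def IsVeryWeakSolution (T : ℝ) (g₀ g₁ : ℝ → ℂ) (u : ℝ → ℝ → ℝ → ℂ) : Prop :=
  ∃ φ : ℝ → ℝ, IsMollifier φ ∧ ∃ κ : ℝ → ℝ, IsScale κ ∧
    ∀ ε ∈ Ioc (0 : ℝ) 1,
      IsSmoothSolution T (fun t => regHeaviside φ (κ ε) (t - 1)) g₀ g₁ (u ε)

/-- The piecewise distributional solution: `g₀ + t g₁` before time `1`, and afterwards
d'Alembert's formula with data `g₀ + g₁` and `g₁` at time `1`. -/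
def piecewiseSolution (g₀ g₁ : ℝ → ℂ) (t x : ℝ) : ℂ :=
  if t < 1 then g₀ x + (t : ℂ) * g₁ x
  else
    (g₁ (x + t - 1) + g₁ (x - t + 1) + g₀ (x + t - 1) + g₀ (x - t + 1)) / 2
      + (1 / 2) * ∫ s in (x - t + 1)..(x + t - 1), g₁ s

/-- The Hilbert space `L²(ℝ)`. -/
abbrev L2 : Type := Lp ℂ 2 (volume : Measure ℝ)

/-- The curve `W` in `L²(ℝ)` belongs to `C¹([0,T]; L²(ℝ))` and represents the function
`w(t,x)`. -/
structure RepresentsC1L2 (T : ℝ) (W : ℝ → L2) (w : ℝ → ℝ → ℂ) : Prop where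
  contDiffOn : ContDiffOn ℝ 1 W (Icc 0 T)
  ae_eq : ∀ t ∈ Icc 0 T, ∀ᵐ x : ℝ, W t x = w t x

/-- The functions `u ε`, `ε ∈ (0,1]`, and `v` belong to `C¹([0,T]; L²(ℝ))`, and `u ε → v` in
that space as `ε → 0⁺`. -/
def ConvergesInC1L2 (T : ℝ) (u : ℝ → ℝ → ℝ → ℂ) (v : ℝ → ℝ → ℂ) : Prop :=
  ∃ (U : ℝ → ℝ → L2) (V : ℝ → L2),
    (∀ ε ∈ Ioc (0 : ℝ) 1, RepresentsC1L2 T (U ε) (u ε)) ∧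
    RepresentsC1L2 T V v ∧
    TendstoUniformlyOn U V (𝓝[>] 0) (Icc 0 T) ∧
    TendstoUniformlyOn (fun ε => derivWithin (U ε) (Icc 0 T)) (derivWithin V (Icc 0 T))
      (𝓝[>] 0) (Icc 0 T)

end HeavisideWave

end

/-! Let `φ` vanish for `|t| ≥ R` and put `ρ = R κ(ε)`. The coefficient `a(t) = H_ε(t-1)` is
nondecreasing with values in `[0,1]`, vanishes up to time `1 - ρ` and equals `1` from time `1 + ρ`
on. Everything rests on controlling the solution through this short window, where `a` has no
positive lower bound and `a'` is of size `1/κ(ε)`.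

The difference `w = u_ε - (g₀ + t g₁)` has zero Cauchy data and solves `w_tt = a (w_xx + h)` with `h
= g₀'' + t g₁''`. Its natural energy is `∫ |w_t|²/a + |w_x|²`. As `a` is nondecreasing,
differentiating `1/a` gives a term of good sign, so no bound on `a'` is needed. The source costs `2
Re(w_t h̄) ≤ |w_t|²/a + a|h|²`, and Grönwall bounds the energy by a constant times `∫ a`, which is
at most `2ρ` up to time `1 + ρ`. Where `a` vanishes, `a + δ` replaces it in the denominator and `δ →
0` at the end (`energy_le_of_degenerate`).

The function `ū - (g₀ + t g₁)` has zero Cauchy data at time `1`, and afterwards its energy is `O(t -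
1)` (`exists_jet_piecewise`). Hence `u_ε - ū` has energy `O(ρ)` at time `1 + ρ`, from where both
functions solve the same wave equation of unit speed, so the bound persists
(`integral_velocity_sub_sq_le`). This gives uniform convergence of the time derivatives in `L²`;
integrating in time from the common initial value gives that of the functions.

The same energy with a weight supported in a backward cone yields finite speed of propagation
(`deriv_eq_zero_of_cone`). All functions thus vanish outside one interval `[-L,L]`: boundary terms
disappear, and joint continuity upgrades to `C¹` in time with values in `L²`
(`representsC1L2_toL2`). -/

noncomputable section

namespace HeavisideWave

/-! ### Integrals over a bounded interval that depend on time. -/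

section Parametric

variable {E : Type*} [NormedAddCommGroup E] [NormedSpace ℝ E]

theorem continuousOn_slice {F : Type*} [TopologicalSpace F] {f : ℝ → ℝ → F} {I : Set ℝ}
    (hf : ContinuousOn (fun q : ℝ × ℝ => f q.1 q.2) (I ×ˢ univ)) {t : ℝ} (ht : t ∈ I) :
    Continuous (f t) := by
  rw [← continuousOn_univ]
  exact hf.comp (by fun_prop : ContinuousOn (fun x : ℝ => (t, x)) univ) fun x _ => ⟨ht, mem_univ _⟩

theorem exists_bound_of_continuousOn_strip {E : Type*} [NormedAddCommGroup E]
    {f : ℝ → ℝ → E} {s S : ℝ} (l m : ℝ)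
    (hf : ContinuousOn (fun q : ℝ × ℝ => f q.1 q.2) (Icc s S ×ˢ univ)) :
    ∃ C, 0 ≤ C ∧ ∀ t ∈ Icc s S, ∀ x ∈ Icc l m, ‖f t x‖ ≤ C := by
  obtain ⟨C, hC⟩ := (isCompact_Icc.prod isCompact_Icc).exists_bound_of_continuousOn
    (hf.mono (prod_mono_right (subset_univ (Icc l m))))
  exact ⟨max C 0, le_max_right _ _,
    fun t ht x hx => (hC (t, x) ⟨ht, hx⟩).trans (le_max_left _ _)⟩

theorem continuousOn_intervalIntegral_strip {f : ℝ → ℝ → E} {s S : ℝ} (hs : s ≤ S) (l m : ℝ)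
    (hf : ContinuousOn (fun q : ℝ × ℝ => f q.1 q.2) (Icc s S ×ˢ univ)) :
    ContinuousOn (fun t => ∫ x in l..m, f t x) (Icc s S) := by
  -- Freezing time at the end points of `[s,S]` extends `f` continuously to the whole plane.
  have hc : Continuous (fun q : ℝ × ℝ => f (projIcc s S hs q.1) q.2) :=
    hf.comp_continuous (f := fun q : ℝ × ℝ => ((projIcc s S hs q.1 : ℝ), q.2)) (by fun_prop)
      fun q => ⟨Subtype.coe_prop _, mem_univ _⟩
  have := intervalIntegral.continuous_parametric_intervalIntegral_of_continuous' (μ := volume)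
    (f := fun t x => f (projIcc s S hs t) x) hc l m
  refine this.continuousOn.congr fun t ht => ?_
  simp only [projIcc_of_mem hs ht]

theorem hasDerivAt_intervalIntegral_strip {f f' : ℝ → ℝ → E} {s S t₀ l m : ℝ} (hlm : l ≤ m)
    (ht₀ : t₀ ∈ Ioo s S)
    (hf : ContinuousOn (fun q : ℝ × ℝ => f q.1 q.2) (Icc s S ×ˢ univ))
    (hf' : ContinuousOn (fun q : ℝ × ℝ => f' q.1 q.2) (Icc s S ×ˢ univ))
    (hd : ∀ t ∈ Ioo s S, ∀ x, HasDerivAt (fun r => f r x) (f' t x) t) :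
    HasDerivAt (fun t => ∫ x in l..m, f t x) (∫ x in l..m, f' t₀ x) t₀ := by
  obtain ⟨C, -, hC⟩ := exists_bound_of_continuousOn_strip l m hf'
  have ht₀' := Ioo_subset_Icc_self ht₀
  refine (intervalIntegral.hasDerivAt_integral_of_dominated_loc_of_deriv_le (μ := volume)
    (s := Ioo s S) (F := f) (F' := f') (bound := fun _ => C) (Ioo_mem_nhds ht₀.1 ht₀.2) ?_ ?_ ?_
    ?_ ?_ ?_).2
  · filter_upwards [Ioo_mem_nhds ht₀.1 ht₀.2] with t ht
    exact (continuousOn_slice hf (Ioo_subset_Icc_self ht)).aestronglyMeasurable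
  · exact (continuousOn_slice hf ht₀').intervalIntegrable _ _
  · exact (continuousOn_slice hf' ht₀').aestronglyMeasurable
  · refine Eventually.of_forall fun x hx t ht => hC t (Ioo_subset_Icc_self ht) x ?_
    rw [uIoc_of_le hlm] at hx
    exact Ioc_subset_Icc_self hx
  · exact intervalIntegrable_const
  · exact Eventually.of_forall fun x _ t ht => hd t ht x

end Parametric

/-! ### Weighted energy inequality for a nondecreasing positive coefficient. -/

/-- First and second order partial derivatives, on the strip `[s,S] × ℝ`, of a `C²` function. -/
structure IsWaveJet (s S : ℝ) (wt wx wtt wtx wxx : ℝ → ℝ → ℂ) : Prop where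
  cont_t : ContinuousOn (fun q : ℝ × ℝ => wt q.1 q.2) (Icc s S ×ˢ univ)
  cont_x : ContinuousOn (fun q : ℝ × ℝ => wx q.1 q.2) (Icc s S ×ˢ univ)
  cont_tt : ContinuousOn (fun q : ℝ × ℝ => wtt q.1 q.2) (Icc s S ×ˢ univ)
  cont_tx : ContinuousOn (fun q : ℝ × ℝ => wtx q.1 q.2) (Icc s S ×ˢ univ)
  cont_xx : ContinuousOn (fun q : ℝ × ℝ => wxx q.1 q.2) (Icc s S ×ˢ univ)
  deriv_tt : ∀ t ∈ Icc s S, ∀ x, HasDerivWithinAt (fun r => wt r x) (wtt t x) (Icc s S) t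
  deriv_xt : ∀ t ∈ Icc s S, ∀ x, HasDerivWithinAt (fun r => wx r x) (wtx t x) (Icc s S) t
  deriv_tx : ∀ t ∈ Icc s S, ∀ x, HasDerivAt (wt t) (wtx t x) x
  deriv_xx : ∀ t ∈ Icc s S, ∀ x, HasDerivAt (wx t) (wxx t x) x

theorem IsWaveJet.sub {s S : ℝ} {wt wx wtt wtx wxx vt vx vtt vtx vxx : ℝ → ℝ → ℂ}
    (hw : IsWaveJet s S wt wx wtt wtx wxx) (hv : IsWaveJet s S vt vx vtt vtx vxx) :
    IsWaveJet s S (fun t x => wt t x - vt t x) (fun t x => wx t x - vx t x)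
      (fun t x => wtt t x - vtt t x) (fun t x => wtx t x - vtx t x)
      (fun t x => wxx t x - vxx t x) where
  cont_t := hw.cont_t.sub hv.cont_t
  cont_x := hw.cont_x.sub hv.cont_x
  cont_tt := hw.cont_tt.sub hv.cont_tt
  cont_tx := hw.cont_tx.sub hv.cont_tx
  cont_xx := hw.cont_xx.sub hv.cont_xx
  deriv_tt t ht x := (hw.deriv_tt t ht x).sub (hv.deriv_tt t ht x)
  deriv_xt t ht x := (hw.deriv_xt t ht x).sub (hv.deriv_xt t ht x)
  deriv_tx t ht x := (hw.deriv_tx t ht x).sub (hv.deriv_tx t ht x)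
  deriv_xx t ht x := (hw.deriv_xx t ht x).sub (hv.deriv_xx t ht x)

theorem IsWaveJet.mono {s S s' S' : ℝ} {wt wx wtt wtx wxx : ℝ → ℝ → ℂ}
    (hw : IsWaveJet s S wt wx wtt wtx wxx) (h : Icc s' S' ⊆ Icc s S) :
    IsWaveJet s' S' wt wx wtt wtx wxx where
  cont_t := hw.cont_t.mono (prod_mono_left h)
  cont_x := hw.cont_x.mono (prod_mono_left h)
  cont_tt := hw.cont_tt.mono (prod_mono_left h)
  cont_tx := hw.cont_tx.mono (prod_mono_left h)
  cont_xx := hw.cont_xx.mono (prod_mono_left h)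
  deriv_tt t ht x := (hw.deriv_tt t (h ht) x).mono h
  deriv_xt t ht x := (hw.deriv_xt t (h ht) x).mono h
  deriv_tx t ht x := hw.deriv_tx t (h ht) x
  deriv_xx t ht x := hw.deriv_xx t (h ht) x

/-- A nonnegative `C¹` weight that decreases in time at least twice as fast as it varies in
space, for `t ∈ [s,S]`. -/
structure IsWeight (s S : ℝ) (p pt px : ℝ → ℝ → ℝ) : Prop where
  cont : Continuous fun q : ℝ × ℝ => p q.1 q.2
  cont_t : Continuous fun q : ℝ × ℝ => pt q.1 q.2
  cont_x : Continuous fun q : ℝ × ℝ => px q.1 q.2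
  deriv_t : ∀ t x, HasDerivAt (fun r => p r x) (pt t x) t
  deriv_x : ∀ t x, HasDerivAt (p t) (px t x) x
  nonneg : ∀ t x, 0 ≤ p t x
  decay : ∀ t ∈ Icc s S, ∀ x, 2 * |px t x| ≤ -pt t x

theorem isWeight_one (s S : ℝ) : IsWeight s S (fun _ _ => 1) (fun _ _ => 0) (fun _ _ => 0) where
  cont := by fun_prop
  cont_t := by fun_prop
  cont_x := by fun_prop
  deriv_t _ _ := hasDerivAt_const _ _
  deriv_x _ _ := hasDerivAt_const _ _
  nonneg _ _ := zero_le_one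
  decay _ _ _ := by simp

/-- The energy density of a wave with squared speed `c`. -/
def energyDensity (c : ℝ → ℝ) (wt wx : ℝ → ℝ → ℂ) (t x : ℝ) : ℝ :=
  ‖wt t x‖ ^ 2 / c t + ‖wx t x‖ ^ 2

/-- The weighted energy on the interval `[l,m]`. -/
def energy (l m : ℝ) (p : ℝ → ℝ → ℝ) (c : ℝ → ℝ) (wt wx : ℝ → ℝ → ℂ) (t : ℝ) : ℝ :=
  ∫ x in l..m, p t x * energyDensity c wt wx t x

theorem continuousOn_energyDensity {s S : ℝ} {c : ℝ → ℝ} {wt wx : ℝ → ℝ → ℂ}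
    (hwt : ContinuousOn (fun q : ℝ × ℝ => wt q.1 q.2) (Icc s S ×ˢ univ))
    (hwx : ContinuousOn (fun q : ℝ × ℝ => wx q.1 q.2) (Icc s S ×ˢ univ))
    (hc : Continuous c) (hc0 : ∀ t ∈ Icc s S, 0 < c t) :
    ContinuousOn (fun q : ℝ × ℝ => energyDensity c wt wx q.1 q.2) (Icc s S ×ˢ univ) :=
  ((hwt.norm.pow 2).div (hc.comp continuous_fst).continuousOn
    fun q hq => (hc0 q.1 hq.1).ne').add (hwx.norm.pow 2)

/-- The left side is the time derivative of the weighted energy density. The last bracket on the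
right is the exact `x`-derivative of `2 p ⟨wt, wx⟩`, so it integrates to boundary terms; `β` is what
remains of the source. -/
theorem energy_deriv_pointwise {c c' p pt px β : ℝ} {wt wx wtt wtx wxx : ℂ}
    (hc0 : 0 < c) (hc2 : c ≤ 2) (hc' : 0 ≤ c') (hp : 0 ≤ p) (hdec : 2 * |px| ≤ -pt)
    (hβ : p * (2 * inner ℝ wt (wtt / (c : ℂ) - wxx)) ≤ p * (‖wt‖ ^ 2 / c) + β) :
    pt * (‖wt‖ ^ 2 / c + ‖wx‖ ^ 2)
      + p * ((2 * inner ℝ wt wtt * c - ‖wt‖ ^ 2 * c') / c ^ 2 + 2 * inner ℝ wx wtx)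
      ≤ p * (‖wt‖ ^ 2 / c + ‖wx‖ ^ 2) + β
        + (2 * px * inner ℝ wt wx + 2 * p * (inner ℝ wt wxx + inner ℝ wtx wx)) := by
  have h1 : inner ℝ wt (wtt / (c : ℂ)) = inner ℝ wt wtt / c := by
    have : wtt / (c : ℂ) = c⁻¹ • wtt := by
      rw [Complex.real_smul, Complex.ofReal_inv, div_eq_inv_mul]
    rw [this, inner_smul_right, div_eq_inv_mul]
  rw [inner_sub_right, h1] at hβ
  have h2 : inner ℝ wx wtx = inner ℝ wtx wx := real_inner_comm _ _
  rw [h2]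
  have h3 : (2 * inner ℝ wt wtt * c - ‖wt‖ ^ 2 * c') / c ^ 2
      = 2 * (inner ℝ wt wtt / c) - ‖wt‖ ^ 2 * c' / c ^ 2 := by
    field_simp
  rw [h3]
  -- Monotonicity of the coefficient: this term enters with a minus sign and is dropped.
  have h4 : 0 ≤ p * (‖wt‖ ^ 2 * c' / c ^ 2) := by positivity
  -- With `c ≤ 2` the energy density dominates the flux `⟨wt, wx⟩`, so a weight that decays at speed
  -- `2` absorbs the term in `px`.
  have h5 : ‖wt‖ ^ 2 ≤ 2 * (‖wt‖ ^ 2 / c) := by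
    rw [mul_div_assoc', le_div_iff₀ hc0]
    nlinarith [sq_nonneg ‖wt‖]
  have h6 : |inner ℝ wt wx| ≤ ‖wt‖ ^ 2 / c + ‖wx‖ ^ 2 := by
    have := abs_real_inner_le_norm wt wx
    nlinarith [sq_nonneg (‖wt‖ - ‖wx‖), sq_nonneg ‖wx‖]
  have h7 : -(2 * px * inner ℝ wt wx) ≤ -pt * (‖wt‖ ^ 2 / c + ‖wx‖ ^ 2) := by
    calc -(2 * px * inner ℝ wt wx) ≤ |2 * px * inner ℝ wt wx| := neg_le_abs _
      _ = 2 * |px| * |inner ℝ wt wx| := by rw [abs_mul, abs_mul, abs_two]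
      _ ≤ -pt * (‖wt‖ ^ 2 / c + ‖wx‖ ^ 2) :=
        mul_le_mul hdec h6 (abs_nonneg _) ((by positivity : 0 ≤ 2 * |px|).trans hdec)
  have h8 : 0 ≤ p * ‖wx‖ ^ 2 := by positivity
  linarith

theorem hasDerivAt_energyDensity {s S : ℝ} {c c' : ℝ → ℝ} {wt wx wtt wtx wxx : ℝ → ℝ → ℂ}
    (hw : IsWaveJet s S wt wx wtt wtx wxx) (hcd : ∀ t, HasDerivAt c (c' t) t)
    (hc0 : ∀ t ∈ Icc s S, 0 < c t) {t : ℝ} (ht : t ∈ Ioo s S) (x : ℝ) :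
    HasDerivAt (fun r => energyDensity c wt wx r x)
      ((2 * inner ℝ (wt t x) (wtt t x) * c t - ‖wt t x‖ ^ 2 * c' t) / c t ^ 2
        + 2 * inner ℝ (wx t x) (wtx t x)) t := by
  have htI := Ioo_subset_Icc_self ht
  have hn := Icc_mem_nhds ht.1 ht.2
  exact ((((hw.deriv_tt t htI x).hasDerivAt hn).norm_sq).div (hcd t) (hc0 t htI).ne').add
    (((hw.deriv_xt t htI x).hasDerivAt hn).norm_sq)

/-- The energy inequality in differential form. -/
theorem energy_deriv_le {s S l m : ℝ} (hlm : l ≤ m) {c c' β : ℝ → ℝ} {p pt px : ℝ → ℝ → ℝ}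
    {wt wx wtt wtx wxx : ℝ → ℝ → ℂ} (hw : IsWaveJet s S wt wx wtt wtx wxx)
    (hp : IsWeight s S p pt px) (hcd : ∀ t, HasDerivAt c (c' t) t) (hcc : Continuous c')
    (hc0 : ∀ t ∈ Icc s S, 0 < c t) (hc2 : ∀ t ∈ Icc s S, c t ≤ 2) (hc' : ∀ t ∈ Icc s S, 0 ≤ c' t)
    (hl : ∀ t ∈ Icc s S, p t l * inner ℝ (wt t l) (wx t l) = 0)
    (hm : ∀ t ∈ Icc s S, p t m * inner ℝ (wt t m) (wx t m) = 0)
    (hβ : ∀ t ∈ Icc s S, ∀ x ∈ Icc l m,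
      p t x * (2 * inner ℝ (wt t x) (wtt t x / (c t : ℂ) - wxx t x))
        ≤ p t x * (‖wt t x‖ ^ 2 / c t) + β t) {t : ℝ} (ht : t ∈ Ioo s S) :
    ∃ D, HasDerivAt (energy l m p c wt wx) D t ∧ D ≤ energy l m p c wt wx t + (m - l) * β t := by
  have hcont : Continuous c := continuous_iff_continuousAt.2 fun t => (hcd t).continuousAt
  have htI := Ioo_subset_Icc_self ht
  have hec := continuousOn_energyDensity hw.cont_t hw.cont_x hcont hc0
  have hedc : ContinuousOn (fun q : ℝ × ℝ =>
      (2 * inner ℝ (wt q.1 q.2) (wtt q.1 q.2) * c q.1 - ‖wt q.1 q.2‖ ^ 2 * c' q.1) / c q.1 ^ 2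
        + 2 * inner ℝ (wx q.1 q.2) (wtx q.1 q.2)) (Icc s S ×ˢ univ) := by
    have hc1 : ContinuousOn (fun q : ℝ × ℝ => c q.1) (Icc s S ×ˢ univ) :=
      (hcont.comp continuous_fst).continuousOn
    have hc1' : ContinuousOn (fun q : ℝ × ℝ => c' q.1) (Icc s S ×ˢ univ) :=
      (hcc.comp continuous_fst).continuousOn
    exact ((((continuousOn_const.mul (ContinuousOn.inner hw.cont_t hw.cont_tt)).mul hc1).sub
      ((hw.cont_t.norm.pow 2).mul hc1')).div (hc1.pow 2)
      fun q hq => (pow_pos (hc0 q.1 hq.1) 2).ne').add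
      (continuousOn_const.mul (ContinuousOn.inner hw.cont_x hw.cont_tx))
  have hfc : ContinuousOn (fun q : ℝ × ℝ => p q.1 q.2 * energyDensity c wt wx q.1 q.2)
      (Icc s S ×ˢ univ) := hp.cont.continuousOn.mul hec
  have hf'c := (hp.cont_t.continuousOn.mul hec).add (hp.cont.continuousOn.mul hedc)
  have hder := hasDerivAt_intervalIntegral_strip hlm ht
    (f := fun t x => p t x * energyDensity c wt wx t x)
    (f' := fun t x => pt t x * energyDensity c wt wx t x + p t x *
      ((2 * inner ℝ (wt t x) (wtt t x) * c t - ‖wt t x‖ ^ 2 * c' t) / c t ^ 2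
        + 2 * inner ℝ (wx t x) (wtx t x))) hfc hf'c
    fun r hr x => (hp.deriv_t r x).mul (hasDerivAt_energyDensity hw hcd hc0 hr x)
  refine ⟨_, hder, ?_⟩
  have hflux : ∀ x, HasDerivAt (fun y => 2 * p t y * inner ℝ (wt t y) (wx t y))
      (2 * px t x * inner ℝ (wt t x) (wx t x) + 2 * p t x *
        (inner ℝ (wt t x) (wxx t x) + inner ℝ (wtx t x) (wx t x))) x := fun x =>
    ((hp.deriv_x t x).const_mul 2).mul
      ((hw.deriv_tx t htI x).inner ℝ (hw.deriv_xx t htI x))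
  have hfluxc : Continuous fun x => 2 * px t x * inner ℝ (wt t x) (wx t x) + 2 * p t x *
        (inner ℝ (wt t x) (wxx t x) + inner ℝ (wtx t x) (wx t x)) := by
    have h1 := continuousOn_slice hp.cont.continuousOn htI
    have h2 := continuousOn_slice hp.cont_x.continuousOn htI
    have h3 := continuousOn_slice hw.cont_t htI
    have h4 := continuousOn_slice hw.cont_x htI
    have h5 := continuousOn_slice hw.cont_tx htI
    have h6 := continuousOn_slice hw.cont_xx htI
    fun_prop
  have hzero : ∫ x in l..m, (2 * px t x * inner ℝ (wt t x) (wx t x) + 2 * p t x *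
        (inner ℝ (wt t x) (wxx t x) + inner ℝ (wtx t x) (wx t x))) = 0 := by
    rw [intervalIntegral.integral_eq_sub_of_hasDerivAt (fun x _ => hflux x)
      (hfluxc.intervalIntegrable _ _)]
    rw [mul_assoc, mul_assoc, hl t htI, hm t htI]
    simp
  have hfi : IntervalIntegrable (fun x => p t x * energyDensity c wt wx t x) volume l m :=
    (continuousOn_slice (f := fun t x => p t x * energyDensity c wt wx t x)
      hfc htI).intervalIntegrable _ _
  calc _ ≤ ∫ x in l..m, (p t x * energyDensity c wt wx t x + β t
        + (2 * px t x * inner ℝ (wt t x) (wx t x) + 2 * p t x *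
        (inner ℝ (wt t x) (wxx t x) + inner ℝ (wtx t x) (wx t x)))) := by
        refine intervalIntegral.integral_mono_on hlm
          ((continuousOn_slice (f := fun t x => pt t x * energyDensity c wt wx t x + p t x *
            ((2 * inner ℝ (wt t x) (wtt t x) * c t - ‖wt t x‖ ^ 2 * c' t) / c t ^ 2
            + 2 * inner ℝ (wx t x) (wtx t x))) hf'c htI).intervalIntegrable _ _)
          ((hfi.add intervalIntegrable_const).add (hfluxc.intervalIntegrable _ _)) fun x hx => ?_
        exact energy_deriv_pointwise (hc0 t htI) (hc2 t htI) (hc' t htI) (hp.nonneg t x)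
          (hp.decay t htI x) (hβ t htI x hx)
    _ = energy l m p c wt wx t + (m - l) * β t := by
        rw [intervalIntegral.integral_add (hfi.add intervalIntegrable_const)
          (hfluxc.intervalIntegrable _ _), hzero,
          intervalIntegral.integral_add hfi intervalIntegrable_const,
          intervalIntegral.integral_const, smul_eq_mul, add_zero]
        rfl

/-- The energy inequality in integrated form. -/
theorem energy_le {s S l m : ℝ} (hlm : l ≤ m) {c c' β : ℝ → ℝ} {p pt px : ℝ → ℝ → ℝ}
    {wt wx wtt wtx wxx : ℝ → ℝ → ℂ} (hw : IsWaveJet s S wt wx wtt wtx wxx)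
    (hp : IsWeight s S p pt px) (hcd : ∀ t, HasDerivAt c (c' t) t) (hcc : Continuous c')
    (hc0 : ∀ t ∈ Icc s S, 0 < c t) (hc2 : ∀ t ∈ Icc s S, c t ≤ 2) (hc' : ∀ t ∈ Icc s S, 0 ≤ c' t)
    (hl : ∀ t ∈ Icc s S, p t l * inner ℝ (wt t l) (wx t l) = 0)
    (hm : ∀ t ∈ Icc s S, p t m * inner ℝ (wt t m) (wx t m) = 0)
    (hβc : Continuous β) (hβ0 : ∀ t ∈ Icc s S, 0 ≤ β t)
    (hβ : ∀ t ∈ Icc s S, ∀ x ∈ Icc l m,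
      p t x * (2 * inner ℝ (wt t x) (wtt t x / (c t : ℂ) - wxx t x))
        ≤ p t x * (‖wt t x‖ ^ 2 / c t) + β t) {t : ℝ} (ht : t ∈ Icc s S) :
    energy l m p c wt wx t
      ≤ Real.exp (t - s) * (energy l m p c wt wx s + (m - l) * ∫ r in s..t, β r) := by
  have hcont : Continuous c := continuous_iff_continuousAt.2 fun t => (hcd t).continuousAt
  have hsS : s ≤ S := ht.1.trans ht.2
  have hec := continuousOn_energyDensity hw.cont_t hw.cont_x hcont hc0
  have hGc : ContinuousOn (energy l m p c wt wx) (Icc s S) :=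
    continuousOn_intervalIntegral_strip (f := fun t x => p t x * energyDensity c wt wx t x)
      hsS l m (hp.cont.continuousOn.mul hec)
  have hexp : ∀ r, HasDerivAt (fun r => Real.exp (-(r - s))) (-Real.exp (-(r - s))) r := by
    intro r
    simpa using (((hasDerivAt_id r).sub_const s).neg).exp
  have hI : ∀ r, HasDerivAt (fun r => ∫ q in s..r, β q) (β r) r := fun r =>
    (hβc.integral_hasStrictDerivAt s r).hasDerivAt
  have hcon : ContinuousOn (fun r => Real.exp (-(r - s)) * energy l m p c wt wx r
      - (m - l) * ∫ q in s..r, β q) (Icc s S) := by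
    refine ((ContinuousOn.mul (by fun_prop) hGc)).sub (continuousOn_const.mul ?_)
    exact fun r _ => (hI r).continuousAt.continuousWithinAt
  -- Grönwall with an integrating factor: the derivative is at most `(exp (-(r - s)) - 1) (m - l) β
  -- r ≤ 0`.
  have hK : AntitoneOn (fun r => Real.exp (-(r - s)) * energy l m p c wt wx r
      - (m - l) * ∫ q in s..r, β q) (Icc s S) := by
    have key : ∀ r ∈ Ioo s S, ∃ D, HasDerivAt (fun r => Real.exp (-(r - s))
        * energy l m p c wt wx r - (m - l) * ∫ q in s..r, β q) D r ∧ D ≤ 0 := by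
      intro r hr
      obtain ⟨D, hD, hDle⟩ := energy_deriv_le hlm hw hp hcd hcc hc0 hc2 hc' hl hm hβ hr
      refine ⟨_, ((hexp r).mul hD).sub ((hI r).const_mul (m - l)), ?_⟩
      have h1 : Real.exp (-(r - s)) ≤ 1 := Real.exp_le_one_iff.2 (by linarith [hr.1])
      have h2 := Real.exp_pos (-(r - s))
      have h3 : 0 ≤ (m - l) * β r :=
        mul_nonneg (sub_nonneg.2 hlm) (hβ0 r (Ioo_subset_Icc_self hr))
      nlinarith
    refine antitoneOn_of_deriv_nonpos (convex_Icc s S) hcon ?_ ?_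
    · rw [interior_Icc]
      intro r hr
      obtain ⟨D, hD, -⟩ := key r hr
      exact hD.differentiableAt.differentiableWithinAt
    · rw [interior_Icc]
      intro r hr
      obtain ⟨D, hD, hD0⟩ := key r hr
      rw [hD.deriv]
      exact hD0
  have := hK (left_mem_Icc.2 hsS) ht ht.1
  simp only [sub_self, neg_zero, Real.exp_zero, one_mul, intervalIntegral.integral_same,
    mul_zero, sub_zero] at this
  have h2 : Real.exp (-(t - s)) * energy l m p c wt wx t
      ≤ energy l m p c wt wx s + (m - l) * ∫ q in s..t, β q := by linarith
  calc energy l m p c wt wx t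
      = Real.exp (t - s) * (Real.exp (-(t - s)) * energy l m p c wt wx t) := by
        rw [← mul_assoc, ← Real.exp_add]
        simp
    _ ≤ _ := by gcongr

/-! ### Energy estimate for a coefficient that may vanish. -/

/-- Dividing by `a + δ` instead of `a` turns the source into `a/(a+δ) h - δ/(a+δ) wxx`. Young's
inequality handles the first term, with `a² ≤ a (a + δ)`. The second is `O(δ)` uniformly in `a`,
because `‖wt‖ ≤ C a` compensates the denominator. -/
theorem degenerate_source_pointwise {a δ p P C D H : ℝ} {wt wtt wxx h : ℂ}
    (ha0 : 0 ≤ a) (hδ : 0 < δ) (hp : 0 ≤ p) (hpP : p ≤ P)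
    (heq : wtt = a * (wxx + h)) (hwt : ‖wt‖ ≤ C * a) (hC : 0 ≤ C) (hxx : ‖wxx‖ ≤ D)
    (hh : p * ‖h‖ ^ 2 ≤ H) :
    p * (2 * inner ℝ wt (wtt / ((a + δ : ℝ) : ℂ) - wxx))
      ≤ p * (‖wt‖ ^ 2 / (a + δ)) + (a * H + 2 * P * C * D * δ) := by
  have hc : 0 < a + δ := by linarith
  have hcC : ((a + δ : ℝ) : ℂ) ≠ 0 := Complex.ofReal_ne_zero.2 hc.ne'
  have h1 : wtt / ((a + δ : ℝ) : ℂ) - wxx = (a / (a + δ)) • h - (δ / (a + δ)) • wxx := by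
    rw [Complex.real_smul, Complex.real_smul, heq]
    push_cast at hcC ⊢
    field_simp
    ring
  have hD : 0 ≤ D := (norm_nonneg _).trans hxx
  rw [h1, inner_sub_right, inner_smul_right, inner_smul_right]
  have i1 : 2 * (a / (a + δ) * inner ℝ wt h) ≤ ‖wt‖ ^ 2 / (a + δ) + a * ‖h‖ ^ 2 := by
    have e1 : 2 * (a * inner ℝ wt h) ≤ ‖wt‖ ^ 2 + a ^ 2 * ‖h‖ ^ 2 := by
      have := real_inner_le_norm wt h
      nlinarith [sq_nonneg (‖wt‖ - a * ‖h‖)]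
    have e2 : a ^ 2 * ‖h‖ ^ 2 ≤ a * ‖h‖ ^ 2 * (a + δ) := by
      have : 0 ≤ a * ‖h‖ ^ 2 * δ := by positivity
      nlinarith
    calc 2 * (a / (a + δ) * inner ℝ wt h) = 2 * (a * inner ℝ wt h) / (a + δ) := by ring
      _ ≤ (‖wt‖ ^ 2 + a * ‖h‖ ^ 2 * (a + δ)) / (a + δ) := by gcongr; linarith
      _ = _ := by field_simp
  have i2 : -(δ / (a + δ) * inner ℝ wt wxx) ≤ C * D * δ := by
    have e1 : -inner ℝ wt wxx ≤ C * a * D :=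
      ((neg_le_abs _).trans (abs_real_inner_le_norm wt wxx)).trans
        (mul_le_mul hwt hxx (norm_nonneg _) (by positivity))
    calc -(δ / (a + δ) * inner ℝ wt wxx) = δ / (a + δ) * -inner ℝ wt wxx := by ring
      _ ≤ δ / (a + δ) * (C * a * D) := by gcongr
      _ = C * D * δ * (a / (a + δ)) := by ring
      _ ≤ C * D * δ * 1 := by
          gcongr
          rw [div_le_one hc]
          linarith
      _ = _ := mul_one _
  have i3 : p * (C * D * δ) ≤ P * (C * D * δ) := by gcongr
  have i4 : a * (p * ‖h‖ ^ 2) ≤ a * H := by gcongr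
  calc p * (2 * (a / (a + δ) * inner ℝ wt h - δ / (a + δ) * inner ℝ wt wxx))
      = p * (2 * (a / (a + δ) * inner ℝ wt h)) + 2 * (p * -(δ / (a + δ) * inner ℝ wt wxx)) := by
        ring
    _ ≤ p * (‖wt‖ ^ 2 / (a + δ) + a * ‖h‖ ^ 2) + 2 * (p * (C * D * δ)) := by gcongr
    _ ≤ _ := by nlinarith

/-- Energy bound for `w_tt = a (w_xx + h)` with zero Cauchy data and a nondecreasing coefficient
`a ≥ 0` that may vanish. -/
theorem energy_le_of_degenerate {T l m H : ℝ} (hlm : l ≤ m) {a a' : ℝ → ℝ}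
    {p pt px : ℝ → ℝ → ℝ} {wt wx wtt wtx wxx h : ℝ → ℝ → ℂ}
    (hw : IsWaveJet 0 T wt wx wtt wtx wxx) (hp : IsWeight 0 T p pt px)
    (had : ∀ t, HasDerivAt a (a' t) t) (hac : Continuous a') (ha' : ∀ t, 0 ≤ a' t)
    (ha0 : ∀ t, 0 ≤ a t) (ha1 : ∀ t, a t ≤ 1)
    (heq : ∀ t ∈ Icc 0 T, ∀ x, wtt t x = a t * (wxx t x + h t x))
    (hhc : Continuous fun q : ℝ × ℝ => h q.1 q.2)
    (ht0 : ∀ x, wt 0 x = 0) (hx0 : ∀ x, wx 0 x = 0)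
    (hl : ∀ t ∈ Icc 0 T, p t l * inner ℝ (wt t l) (wx t l) = 0)
    (hm : ∀ t ∈ Icc 0 T, p t m * inner ℝ (wt t m) (wx t m) = 0)
    (hH : ∀ t ∈ Icc 0 T, ∀ x ∈ Icc l m, p t x * ‖h t x‖ ^ 2 ≤ H) (hH0 : 0 ≤ H)
    {t : ℝ} (ht : t ∈ Icc 0 T) :
    energy l m p (fun _ => 1) wt wx t
      ≤ 2 * Real.exp T * (m - l) * H * ∫ r in (0 : ℝ)..t, a r := by
  have hT : 0 ≤ T := ht.1.trans ht.2
  have hcont : Continuous a := continuous_iff_continuousAt.2 fun t => (had t).continuousAt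
  have hmono : Monotone a := monotone_of_deriv_nonneg (fun t => (had t).differentiableAt)
    fun t => by rw [(had t).deriv]; exact ha' t
  obtain ⟨B, hB0, hB⟩ := exists_bound_of_continuousOn_strip (f := fun t x => wxx t x + h t x) l m
    (hw.cont_xx.add hhc.continuousOn)
  obtain ⟨D, hD0, hD⟩ := exists_bound_of_continuousOn_strip l m hw.cont_xx
  obtain ⟨P, hP0, hP⟩ := exists_bound_of_continuousOn_strip (s := 0) (S := T) l m
    hp.cont.continuousOn
  -- The velocity degenerates with `a`: it starts from zero, and on `[0,r]` the acceleration is at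
  -- most `a r * B` by monotonicity.
  have hwt : ∀ r ∈ Icc 0 T, ∀ x ∈ Icc l m, ‖wt r x‖ ≤ T * B * a r := by
    intro r hr x hx
    have hsub : Icc 0 r ⊆ Icc 0 T := Icc_subset_Icc_right hr.2
    have := (convex_Icc 0 r).norm_image_sub_le_of_norm_hasDerivWithin_le
      (f := fun q => wt q x) (f' := fun q => wtt q x) (C := a r * B)
      (fun q hq => (hw.deriv_tt q (hsub hq) x).mono hsub)
      (fun q hq => by
        rw [heq q (hsub hq) x, norm_mul, Complex.norm_real, Real.norm_of_nonneg (ha0 q)]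
        exact mul_le_mul (hmono hq.2) (hB q (hsub hq) x hx) (norm_nonneg _) (ha0 r))
      (left_mem_Icc.2 hr.1) (right_mem_Icc.2 hr.1)
    rw [ht0, sub_zero, sub_zero, Real.norm_of_nonneg hr.1] at this
    refine this.trans ?_
    have h1 : 0 ≤ a r * B := mul_nonneg (ha0 r) hB0
    nlinarith [hr.2]
  set A := ∫ r in (0 : ℝ)..t, a r with hA
  have hδ : ∀ δ ∈ Ioc (0 : ℝ) 1, energy l m p (fun _ => 1) wt wx t
      ≤ 2 * Real.exp T * (m - l) * H * A
        + (2 * Real.exp T * (m - l) * (2 * P * (T * B) * D * T)) * δ := by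
    intro δ hδ
    have hce : ∀ r, 0 < a r + δ := fun r => add_pos_of_nonneg_of_pos (ha0 r) hδ.1
    have hE := energy_le hlm hw hp (c := fun r => a r + δ)
      (β := fun r => a r * H + 2 * P * (T * B) * D * δ)
      (fun r => (had r).add_const δ) hac (fun r _ => hce r)
      (fun r _ => by linarith [ha1 r, hδ.2]) (fun r _ => ha' r) hl hm (by fun_prop)
      (fun r _ => add_nonneg (mul_nonneg (ha0 r) hH0) (by have := hδ.1; positivity))
      (fun r hr x hx => degenerate_source_pointwise (ha0 r) hδ.1 (hp.nonneg r x)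
        ((le_abs_self _).trans (hP r hr x hx)) (heq r hr x) (hwt r hr x hx) (by positivity)
        (hD r hr x hx) (hH r hr x hx)) ht
    have hE0 : energy l m p (fun r => a r + δ) wt wx 0 = 0 := by
      simp [energy, energyDensity, ht0, hx0]
    have hint : ∫ r in (0 : ℝ)..t, (a r * H + 2 * P * (T * B) * D * δ)
        = A * H + t * (2 * P * (T * B) * D * δ) := by
      rw [intervalIntegral.integral_add ((hcont.intervalIntegrable _ _).mul_const H)
        intervalIntegrable_const, intervalIntegral.integral_mul_const,
        intervalIntegral.integral_const, smul_eq_mul, sub_zero]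
    rw [hE0, hint, zero_add, sub_zero] at hE
    -- Since `a + δ ≤ 2`, the unit-speed energy is at most twice the one with denominator `a + δ`;
    -- this is the factor `2` in the conclusion.
    have hcmp : energy l m p (fun _ => 1) wt wx t
        ≤ 2 * energy l m p (fun r => a r + δ) wt wx t := by
      unfold energy
      rw [← intervalIntegral.integral_const_mul]
      have c1 := continuousOn_slice (hp.cont.continuousOn.mul
        (continuousOn_energyDensity hw.cont_t hw.cont_x (continuous_const (y := (1 : ℝ)))
          fun _ _ => one_pos)) ht (f := fun t x => p t x * energyDensity (fun _ => 1) wt wx t x)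
      have c2 := continuousOn_slice (hp.cont.continuousOn.mul
        (continuousOn_energyDensity hw.cont_t hw.cont_x (hcont.add continuous_const)
          fun r _ => hce r)) ht
          (f := fun t x => p t x * energyDensity (fun r => a r + δ) wt wx t x)
      refine intervalIntegral.integral_mono_on hlm (c1.intervalIntegrable _ _)
        ((continuous_const.mul c2).intervalIntegrable _ _) fun x _ => ?_
      have hle : energyDensity (fun _ => 1) wt wx t x
          ≤ 2 * energyDensity (fun r => a r + δ) wt wx t x := by
        unfold energyDensity
        have h5 : ‖wt t x‖ ^ 2 ≤ 2 * (‖wt t x‖ ^ 2 / (a t + δ)) := by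
          rw [mul_div_assoc', le_div_iff₀ (hce t)]
          nlinarith [sq_nonneg ‖wt t x‖, ha1 t, hδ.2]
        have := sq_nonneg ‖wx t x‖
        rw [div_one]
        linarith
      nlinarith [hp.nonneg t x]
    have hA0 : 0 ≤ A := intervalIntegral.integral_nonneg ht.1 fun r _ => ha0 r
    calc _ ≤ _ := hcmp
      _ ≤ 2 * (Real.exp t * ((m - l) * (A * H + t * (2 * P * (T * B) * D * δ)))) := by gcongr
      _ ≤ 2 * (Real.exp T * ((m - l) * (A * H + T * (2 * P * (T * B) * D * δ)))) := by
          have := hδ.1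
          have := sub_nonneg.2 hlm
          have := ht.1
          gcongr
          · exact ht.2
          · exact ht.2
      _ = _ := by ring
  have hlim : Tendsto (fun δ : ℝ => 2 * Real.exp T * (m - l) * H * A
        + (2 * Real.exp T * (m - l) * (2 * P * (T * B) * D * T)) * δ) (𝓝[>] 0)
      (𝓝 (2 * Real.exp T * (m - l) * H * A)) := by
    have : Tendsto (fun δ : ℝ => 2 * Real.exp T * (m - l) * H * A
        + (2 * Real.exp T * (m - l) * (2 * P * (T * B) * D * T)) * δ) (𝓝 0)
      (𝓝 (2 * Real.exp T * (m - l) * H * A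
        + (2 * Real.exp T * (m - l) * (2 * P * (T * B) * D * T)) * 0)) :=
      Continuous.tendsto (by fun_prop) 0
    rw [mul_zero, add_zero] at this
    exact this.mono_left nhdsWithin_le_nhds
  refine ge_of_tendsto hlim ?_
  filter_upwards [Ioc_mem_nhdsGT one_pos] with δ hd using hδ δ hd

/-! ### Cone weights and domain of dependence. -/

/-- The positive part squared, a `C¹` function. -/
theorem hasDerivAt_max_zero_sq (y : ℝ) :
    HasDerivAt (fun y : ℝ => max y 0 ^ 2) (2 * max y 0) y := by
  have hne : ∀ y : ℝ, y ≠ 0 → HasDerivAt (fun y : ℝ => max y 0 ^ 2) (2 * max y 0) y := by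
    intro y hy
    rcases lt_or_gt_of_ne hy with h | h
    · rw [max_eq_right h.le, mul_zero]
      refine (hasDerivAt_const y (0 : ℝ)).congr_of_eventuallyEq ?_
      filter_upwards [Iio_mem_nhds h] with z hz
      simp [max_eq_right (le_of_lt (mem_Iio.1 hz))]
    · rw [max_eq_left h.le]
      have : HasDerivAt (fun y : ℝ => y ^ 2) (2 * y) y := by simpa using hasDerivAt_pow 2 y
      refine this.congr_of_eventuallyEq ?_
      filter_upwards [Ioi_mem_nhds h] with z hz
      simp [max_eq_left (le_of_lt (mem_Ioi.1 hz))]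
  rcases eq_or_ne y 0 with rfl | hy
  -- At the kink the derivative is obtained as the limit of the derivatives nearby.
  · exact hasDerivAt_of_hasDerivAt_of_ne (g := fun y => 2 * max y 0) hne
      (by fun_prop) (by fun_prop)
  · exact hne y hy

/-- A weight supported in the backward cone of speed `2` over the ball of radius `r` about
`x₀`. -/
theorem isWeight_cone {T r x₀ : ℝ} (hr : 2 * T < r) :
    IsWeight 0 T (fun t x => max ((r - 2 * t) ^ 2 - (x - x₀) ^ 2) 0 ^ 2)
      (fun t x => 2 * max ((r - 2 * t) ^ 2 - (x - x₀) ^ 2) 0 * (-4 * (r - 2 * t)))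
      (fun t x => 2 * max ((r - 2 * t) ^ 2 - (x - x₀) ^ 2) 0 * (-2 * (x - x₀))) where
  cont := by fun_prop
  cont_t := by fun_prop
  cont_x := by fun_prop
  deriv_t t x := by
    have h : HasDerivAt (fun t => (r - 2 * t) ^ 2 - (x - x₀) ^ 2) (-4 * (r - 2 * t)) t := by
      have := ((((hasDerivAt_id t).const_mul 2).const_sub r).pow 2).sub_const ((x - x₀) ^ 2)
      refine this.congr_deriv ?_
      simp
      ring
    exact (hasDerivAt_max_zero_sq _).comp t h
  deriv_x t x := by
    have h : HasDerivAt (fun x => (r - 2 * t) ^ 2 - (x - x₀) ^ 2) (-2 * (x - x₀)) x := by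
      have := (((hasDerivAt_id x).sub_const x₀).pow 2).const_sub ((r - 2 * t) ^ 2)
      refine this.congr_deriv ?_
      simp
    exact (hasDerivAt_max_zero_sq _).comp x h
  nonneg t x := by positivity
  decay t ht x := by
    have hρ : 0 < r - 2 * t := by linarith [ht.2]
    rcases le_total ((r - 2 * t) ^ 2 - (x - x₀) ^ 2) 0 with h | h
    · simp [max_eq_right h]
    · rw [max_eq_left h, abs_mul, abs_mul (-2), abs_mul 2, abs_of_nonneg h, abs_neg, abs_two]
      -- On the support of the weight the required inequality reduces to exactly this one.
      have hx : |x - x₀| ≤ r - 2 * t := abs_le_of_sq_le_sq (by linarith) hρ.le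
      nlinarith

/-- Domain of dependence: with zero Cauchy data, `w_t` vanishes on the axis of a cone in which
the source vanishes. -/
theorem deriv_eq_zero_of_cone {T r x₀ : ℝ} {a a' : ℝ → ℝ}
    {wt wx wtt wtx wxx h : ℝ → ℝ → ℂ}
    (hw : IsWaveJet 0 T wt wx wtt wtx wxx) (hr : 2 * T < r)
    (had : ∀ t, HasDerivAt a (a' t) t) (hac : Continuous a') (ha' : ∀ t, 0 ≤ a' t)
    (ha0 : ∀ t, 0 ≤ a t) (ha1 : ∀ t, a t ≤ 1)
    (heq : ∀ t ∈ Icc 0 T, ∀ x, wtt t x = a t * (wxx t x + h t x))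
    (hhc : Continuous fun q : ℝ × ℝ => h q.1 q.2)
    (ht0 : ∀ x, wt 0 x = 0) (hx0 : ∀ x, wx 0 x = 0)
    (hh : ∀ t x, |x - x₀| < r → h t x = 0) {t : ℝ} (ht : t ∈ Icc 0 T) : wt t x₀ = 0 := by
  have hT : 0 ≤ T := ht.1.trans ht.2
  have hr0 : 0 < r := by linarith
  have hout : ∀ t ∈ Icc 0 T, ∀ x, r ≤ |x - x₀| →
      max ((r - 2 * t) ^ 2 - (x - x₀) ^ 2) 0 ^ 2 = 0 := by
    intro t ht x hx
    have h1 : (r - 2 * t) ^ 2 ≤ (x - x₀) ^ 2 := by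
      rw [← sq_abs (x - x₀)]
      exact pow_le_pow_left₀ (by linarith [ht.2]) (by linarith [ht.1]) 2
    rw [max_eq_right (by linarith)]
    simp
  have hp := isWeight_cone (x₀ := x₀) hr
  -- `H = 0` is allowed: at each point of the interval either the source or the weight vanishes. The
  -- energy bound is then `0`.
  have hE := energy_le_of_degenerate (l := x₀ - r) (m := x₀ + r) (H := 0) (by linarith) hw hp
    had hac ha' ha0 ha1 heq hhc ht0 hx0
    (fun t ht => by rw [hout t ht _ (by simp [abs_of_pos hr0]), zero_mul])
    (fun t ht => by rw [hout t ht _ (by simp [abs_of_pos hr0]), zero_mul])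
    (fun t ht x _ => by
      rcases lt_or_ge |x - x₀| r with hx | hx
      · simp [hh t x hx]
      · rw [hout t ht x hx, zero_mul]) le_rfl ht
  rw [mul_zero, zero_mul] at hE
  by_contra hne
  have hc := continuousOn_slice (hp.cont.continuousOn.mul
        (continuousOn_energyDensity hw.cont_t hw.cont_x (continuous_const (y := (1 : ℝ)))
          fun _ _ => one_pos)) ht (f := fun t x => max ((r - 2 * t) ^ 2 - (x - x₀) ^ 2) 0 ^ 2
            * energyDensity (fun _ => 1) wt wx t x)
  have hpos : 0 < energy (x₀ - r) (x₀ + r)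
      (fun t x => max ((r - 2 * t) ^ 2 - (x - x₀) ^ 2) 0 ^ 2) (fun _ => 1) wt wx t := by
    refine intervalIntegral.integral_pos (by linarith) hc.continuousOn (fun x _ => ?_)
      ⟨x₀, ⟨by linarith, by linarith⟩, ?_⟩
    · unfold energyDensity
      positivity
    · have h1 : 0 < r - 2 * t := by linarith [ht.2]
      have h2 : 0 < ‖wt t x₀‖ := norm_pos_iff.2 hne
      simp only [energyDensity]
      rw [sub_self, zero_pow two_ne_zero, sub_zero, max_eq_left (by positivity)]
      positivity
  exact absurd hE (not_le.2 hpos)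

/-! ### Partial derivatives of smooth functions up to the boundary of the strip. -/

section PartialDerivatives

variable {T : ℝ} {F : ℝ × ℝ → ℂ}

theorem uniqueDiffOn_strip (hT : 0 < T) : UniqueDiffOn ℝ (Icc 0 T ×ˢ (univ : Set ℝ)) :=
  (uniqueDiffOn_Icc hT).prod uniqueDiffOn_univ

/-- The directional derivative within the strip `[0,T] × ℝ`. -/
def stripDeriv (T : ℝ) (v : ℝ × ℝ) (F : ℝ × ℝ → ℂ) (q : ℝ × ℝ) : ℂ :=
  fderivWithin ℝ F (Icc 0 T ×ˢ univ) q v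

theorem contDiffOn_stripDeriv (hT : 0 < T) (v : ℝ × ℝ)
    (hF : ContDiffOn ℝ ∞ F (Icc 0 T ×ˢ univ)) :
    ContDiffOn ℝ ∞ (stripDeriv T v F) (Icc 0 T ×ˢ univ) :=
  (((contDiffOn_infty_iff_fderivWithin (uniqueDiffOn_strip hT)).1 hF).2).clm_apply contDiffOn_const

theorem hasDerivWithinAt_stripDeriv (hF : ContDiffOn ℝ ∞ F (Icc 0 T ×ˢ univ)) {t : ℝ}
    (ht : t ∈ Icc 0 T) (x : ℝ) :
    HasDerivWithinAt (fun r => F (r, x)) (stripDeriv T (1, 0) F (t, x)) (Icc 0 T) t := by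
  have h := (hF.differentiableOn (by simp) (t, x) ⟨ht, mem_univ _⟩).hasFDerivWithinAt
  have h2 : HasDerivWithinAt (fun r : ℝ => (r, x)) ((1 : ℝ), (0 : ℝ)) (Icc 0 T) t :=
    (hasDerivWithinAt_id t _).prodMk (hasDerivWithinAt_const t _ x)
  exact h.comp_hasDerivWithinAt t h2 fun r hr => mk_mem_prod hr (mem_univ x)

theorem hasDerivAt_stripDeriv (hF : ContDiffOn ℝ ∞ F (Icc 0 T ×ˢ univ)) {t : ℝ}
    (ht : t ∈ Icc 0 T) (x : ℝ) :
    HasDerivAt (fun y => F (t, y)) (stripDeriv T (0, 1) F (t, x)) x := by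
  have h := (hF.differentiableOn (by simp) (t, x) ⟨ht, mem_univ _⟩).hasFDerivWithinAt
  have h2 : HasDerivWithinAt (fun y : ℝ => (t, y)) ((0 : ℝ), (1 : ℝ)) univ x :=
    (hasDerivWithinAt_const x _ t).prodMk (hasDerivWithinAt_id x _)
  exact (h.comp_hasDerivWithinAt x h2 fun r _ => mk_mem_prod ht (mem_univ r)).hasDerivAt univ_mem

theorem stripDeriv_comm (hT : 0 < T) (hF : ContDiffOn ℝ ∞ F (Icc 0 T ×ˢ univ)) (v w : ℝ × ℝ)
    {q : ℝ × ℝ} (hq : q ∈ Icc 0 T ×ˢ (univ : Set ℝ)) :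
    stripDeriv T v (stripDeriv T w F) q = stripDeriv T w (stripDeriv T v F) q := by
  have hU := uniqueDiffOn_strip hT
  have hd : DifferentiableWithinAt ℝ (fderivWithin ℝ F (Icc 0 T ×ˢ univ)) (Icc 0 T ×ˢ univ) q :=
    ((contDiffOn_infty_iff_fderivWithin hU).1 hF).2.differentiableOn (by simp) q hq
  have key : ∀ v w : ℝ × ℝ, stripDeriv T v (stripDeriv T w F) q
      = fderivWithin ℝ (fderivWithin ℝ F (Icc 0 T ×ˢ univ)) (Icc 0 T ×ˢ univ) q v w := by
    intro v w
    have := (hd.hasFDerivWithinAt.clm_apply (hasFDerivWithinAt_const w q _)).fderivWithin (hU q hq)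
    change fderivWithin ℝ (fun q => fderivWithin ℝ F (Icc 0 T ×ˢ univ) q w) _ q v = _
    rw [this]
    simp
  rw [key, key]
  -- Symmetry of the second derivative extends to boundary points because the strip is the closure
  -- of its interior; `0 < T` is essential here.
  refine ((hF q hq).isSymmSndFDerivWithinAt
    (by simpa using WithTop.coe_le_coe.2 (le_top : (2 : ℕ∞) ≤ ⊤)) hU ?_ hq).eq v w
  rw [interior_prod_eq, interior_Icc, interior_univ, closure_prod_eq, closure_Ioo hT.ne,
    closure_univ]
  exact hq

end PartialDerivatives

theorem IsSmoothSolution.exists_jet {T : ℝ} (hT : 0 < T) {a : ℝ → ℝ} {g₀ g₁ : ℝ → ℂ}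
    {u : ℝ → ℝ → ℂ} (hu : IsSmoothSolution T a g₀ g₁ u) :
    ∃ ut ux utt utx uxx : ℝ → ℝ → ℂ, IsWaveJet 0 T ut ux utt utx uxx ∧
      (∀ t ∈ Icc 0 T, ∀ x, HasDerivWithinAt (fun r => u r x) (ut t x) (Icc 0 T) t) ∧
      (∀ t ∈ Icc 0 T, ∀ x, utt t x = a t * uxx t x) ∧
      (∀ x, ut 0 x = g₁ x) ∧ (∀ x, ux 0 x = deriv g₀ x) := by
  set F : ℝ × ℝ → ℂ := fun q => u q.1 q.2 with hF
  have hs : ContDiffOn ℝ ∞ F (Icc 0 T ×ˢ univ) := hu.smooth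
  have ht := contDiffOn_stripDeriv hT (1, 0) hs
  have hx := contDiffOn_stripDeriv hT (0, 1) hs
  have h0 : (0 : ℝ) ∈ Icc 0 T := left_mem_Icc.2 hT.le
  refine ⟨fun t x => stripDeriv T (1, 0) F (t, x), fun t x => stripDeriv T (0, 1) F (t, x),
    fun t x => stripDeriv T (1, 0) (stripDeriv T (1, 0) F) (t, x),
    fun t x => stripDeriv T (0, 1) (stripDeriv T (1, 0) F) (t, x),
    fun t x => stripDeriv T (0, 1) (stripDeriv T (0, 1) F) (t, x), ?_, ?_, ?_, ?_, ?_⟩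
  · exact
    { cont_t := ht.continuousOn
      cont_x := hx.continuousOn
      cont_tt := (contDiffOn_stripDeriv hT _ ht).continuousOn
      cont_tx := (contDiffOn_stripDeriv hT _ ht).continuousOn
      cont_xx := (contDiffOn_stripDeriv hT _ hx).continuousOn
      deriv_tt := fun t h x => hasDerivWithinAt_stripDeriv ht h x
      deriv_xt := fun t h x => by
        rw [stripDeriv_comm hT hs (0, 1) (1, 0) (mk_mem_prod h (mem_univ x))]
        exact hasDerivWithinAt_stripDeriv hx h x
      deriv_tx := fun t h x => hasDerivAt_stripDeriv ht h x
      deriv_xx := fun t h x => hasDerivAt_stripDeriv hx h x }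
  · exact fun t h x => hasDerivWithinAt_stripDeriv hs h x
  · intro t h x
    have e := hu.equation t h x
    have hUt := uniqueDiffOn_Icc hT
    have e1 : iteratedDerivWithin 2 (fun s => u s x) (Icc 0 T) t
        = stripDeriv T (1, 0) (stripDeriv T (1, 0) F) (t, x) := by
      rw [iteratedDerivWithin_succ]
      have : EqOn (iteratedDerivWithin 1 (fun s => u s x) (Icc 0 T))
          (fun t => stripDeriv T (1, 0) F (t, x)) (Icc 0 T) := by
        intro r hr
        rw [iteratedDerivWithin_one]
        exact (hasDerivWithinAt_stripDeriv hs hr x).derivWithin (hUt r hr)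
      rw [derivWithin_congr this (this h)]
      exact (hasDerivWithinAt_stripDeriv ht h x).derivWithin (hUt t h)
    have e2 : iteratedDeriv 2 (fun y => u t y) x
        = stripDeriv T (0, 1) (stripDeriv T (0, 1) F) (t, x) := by
      rw [iteratedDeriv_succ, iteratedDeriv_one]
      have : deriv (fun y => u t y) = fun y => stripDeriv T (0, 1) F (t, y) :=
        funext fun y => (hasDerivAt_stripDeriv hs h y).deriv
      rw [this]
      exact (hasDerivAt_stripDeriv hx h x).deriv
    rw [e1, e2] at e
    exact sub_eq_zero.1 e
  · intro x
    rw [← hu.initial_deriv x]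
    exact ((hasDerivWithinAt_stripDeriv hs h0 x).derivWithin (uniqueDiffOn_Icc hT 0 h0)).symm
  · intro x
    have : (fun y => u 0 y) = g₀ := funext hu.initial
    rw [← this]
    exact (hasDerivAt_stripDeriv hs h0 x).deriv.symm

/-! ### Classes in `L²` and differentiable curves of compactly supported functions. -/

open Classical in
/-- The class in `L²(ℝ)` of a square integrable function. -/
def toL2 (f : ℝ → ℂ) : L2 := if h : MemLp f 2 (volume : Measure ℝ) then h.toLp f else 0

theorem toL2_of_memLp {f : ℝ → ℂ} (h : MemLp f 2 (volume : Measure ℝ)) :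
    toL2 f = h.toLp f := dif_pos h

theorem memLp_two_of_vanish {f : ℝ → ℂ} {M : ℝ} (hf : Continuous f)
    (hM : ∀ x, M ≤ |x| → f x = 0) : MemLp f 2 (volume : Measure ℝ) := by
  refine hf.memLp_of_hasCompactSupport (HasCompactSupport.intro (isCompact_Icc (a := -M) (b := M))
    fun x hx => hM x ?_)
  by_contra h
  exact hx (abs_le.1 (le_of_not_ge h))

theorem coeFn_toL2 {f : ℝ → ℂ} (h : MemLp f 2 (volume : Measure ℝ)) : toL2 f =ᵐ[volume] f := by
  rw [toL2_of_memLp h]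
  exact h.coeFn_toLp

theorem toL2_sub {f g : ℝ → ℂ} (hf : MemLp f 2 (volume : Measure ℝ))
    (hg : MemLp g 2 (volume : Measure ℝ)) :
    toL2 (fun x => f x - g x) = toL2 f - toL2 g := by
  have h : MemLp (fun x => f x - g x) 2 (volume : Measure ℝ) := hf.sub hg
  rw [toL2_of_memLp hf, toL2_of_memLp hg, toL2_of_memLp h]
  rfl

theorem toL2_smul {f : ℝ → ℂ} (c : ℝ) (hf : MemLp f 2 (volume : Measure ℝ)) :
    toL2 (fun x => c • f x) = c • toL2 f := by
  have h : MemLp (fun x => c • f x) 2 (volume : Measure ℝ) := hf.const_smul c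
  rw [toL2_of_memLp hf, toL2_of_memLp h]
  rfl

theorem norm_toL2_sq {f : ℝ → ℂ} {M : ℝ} (hf : Continuous f) (hM : ∀ x, M ≤ |x| → f x = 0) :
    ‖toL2 f‖ ^ 2 = ∫ x in (-M)..M, ‖f x‖ ^ 2 := by
  have h := memLp_two_of_vanish hf hM
  rw [toL2_of_memLp h, Lp.norm_toLp, h.eLpNorm_eq_integral_rpow_norm (by simp) (by simp),
    ENNReal.toReal_ofReal (by positivity), intervalIntegral.integral_eq_integral_of_support_subset]
  · simp only [ENNReal.toReal_ofNat, Real.rpow_two]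
    rw [← one_div, ← Real.sqrt_eq_rpow, Real.sq_sqrt]
    exact integral_nonneg fun x => by positivity
  · intro x hx
    have : ¬ M ≤ |x| := fun h => hx (by simp [hM x h])
    exact Ioo_subset_Ioc_self (abs_lt.1 (not_le.1 this))

theorem norm_toL2_le {f : ℝ → ℂ} {M C : ℝ} (hM0 : 0 ≤ M) (hf : Continuous f)
    (hM : ∀ x, M ≤ |x| → f x = 0) (hC0 : 0 ≤ C) (hC : ∀ x, ‖f x‖ ≤ C) :
    ‖toL2 f‖ ≤ √(2 * M) * C := by
  refine le_of_sq_le_sq ?_ (by positivity)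
  rw [norm_toL2_sq hf hM, mul_pow, Real.sq_sqrt (by positivity)]
  calc ∫ x in (-M)..M, ‖f x‖ ^ 2 ≤ ∫ _x in (-M)..M, C ^ 2 := by
        refine intervalIntegral.integral_mono_on (by linarith)
          ((hf.norm.pow 2).intervalIntegrable _ _) intervalIntegrable_const fun x _ => ?_
        have := hC x
        gcongr
    _ = 2 * M * C ^ 2 := by
        rw [intervalIntegral.integral_const, smul_eq_mul]
        ring

section Curve

variable {T M : ℝ} {f f' : ℝ → ℝ → ℂ}

/-- Uniform continuity on `[0,T] × [-M,M]`; outside it both slices are zero. On a fixed support the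
sup norm controls the `L²` norm, so this gives continuity in `L²`. -/
theorem eventually_uniform_slice
    (hf : ContinuousOn (fun q : ℝ × ℝ => f q.1 q.2) (Icc 0 T ×ˢ univ))
    (hM : ∀ t ∈ Icc 0 T, ∀ x, M ≤ |x| → f t x = 0) {t : ℝ} (ht : t ∈ Icc 0 T) {η : ℝ}
    (hη : 0 < η) :
    ∃ δ > 0, ∀ r ∈ Icc 0 T, |r - t| < δ → ∀ x, ‖f r x - f t x‖ ≤ η := by
  have hU := (isCompact_Icc.prod isCompact_Icc).uniformContinuousOn_of_continuous
    (hf.mono (prod_mono_right (subset_univ (Icc (-M) M))))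
  obtain ⟨δ, hδ, h⟩ := Metric.uniformContinuousOn_iff.1 hU η hη
  refine ⟨δ, hδ, fun r hr hrt x => ?_⟩
  rcases le_total M |x| with hx | hx
  · rw [hM r hr x hx, hM t ht x hx, sub_zero, norm_zero]
    exact hη.le
  · have := h (r, x) ⟨hr, abs_le.1 hx⟩ (t, x) ⟨ht, abs_le.1 hx⟩
      (by rwa [Prod.dist_eq, dist_self, max_eq_left dist_nonneg, Real.dist_eq])
    rw [dist_eq_norm] at this
    exact this.le

theorem continuousOn_toL2 (hM0 : 0 ≤ M)
    (hf : ContinuousOn (fun q : ℝ × ℝ => f q.1 q.2) (Icc 0 T ×ˢ univ))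
    (hM : ∀ t ∈ Icc 0 T, ∀ x, M ≤ |x| → f t x = 0) :
    ContinuousOn (fun t => toL2 (f t)) (Icc 0 T) := by
  intro t ht
  rw [Metric.continuousWithinAt_iff]
  intro ε hε
  -- The `+ 1` covers `M = 0` and makes the final inequality strict.
  have hη : 0 < ε / (√(2 * M) + 1) := by positivity
  obtain ⟨δ, hδ, h⟩ := eventually_uniform_slice hf hM ht hη
  refine ⟨δ, hδ, fun r hr hrt => ?_⟩
  have hcr := continuousOn_slice hf hr
  have hct := continuousOn_slice hf ht
  rw [dist_eq_norm, ← toL2_sub (memLp_two_of_vanish hcr (hM r hr))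
    (memLp_two_of_vanish hct (hM t ht))]
  refine (norm_toL2_le hM0 (hcr.sub hct)
    (fun x hx => by simp [hM r hr x hx, hM t ht x hx])
    hη.le (h r hr (by rwa [← Real.dist_eq]))).trans_lt ?_
  rw [mul_div_assoc', div_lt_iff₀ (by positivity)]
  nlinarith

theorem hasDerivWithinAt_toL2 (hM0 : 0 ≤ M)
    (hf : ContinuousOn (fun q : ℝ × ℝ => f q.1 q.2) (Icc 0 T ×ˢ univ))
    (hf' : ContinuousOn (fun q : ℝ × ℝ => f' q.1 q.2) (Icc 0 T ×ˢ univ))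
    (hM : ∀ t ∈ Icc 0 T, ∀ x, M ≤ |x| → f t x = 0)
    (hM' : ∀ t ∈ Icc 0 T, ∀ x, M ≤ |x| → f' t x = 0)
    (hd : ∀ t ∈ Icc 0 T, ∀ x, HasDerivWithinAt (fun r => f r x) (f' t x) (Icc 0 T) t)
    {t : ℝ} (ht : t ∈ Icc 0 T) :
    HasDerivWithinAt (fun t => toL2 (f t)) (toL2 (f' t)) (Icc 0 T) t := by
  rw [hasDerivWithinAt_iff_isLittleO, Asymptotics.isLittleO_iff]
  intro c hc
  have hη : 0 < c / (√(2 * M) + 1) := by positivity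
  obtain ⟨δ, hδ, h⟩ := eventually_uniform_slice hf' hM' ht hη
  filter_upwards [self_mem_nhdsWithin, mem_nhdsWithin_of_mem_nhds (Metric.ball_mem_nhds t hδ)]
    with r hr hrt
  have hrt' : |r - t| < δ := by rwa [← Real.dist_eq]
  have hcr := continuousOn_slice hf hr
  have hct := continuousOn_slice hf ht
  have hct' := continuousOn_slice hf' ht
  have m1 := memLp_two_of_vanish hcr (hM r hr)
  have m2 := memLp_two_of_vanish hct (hM t ht)
  have m3 := memLp_two_of_vanish hct' (hM' t ht)
  have m4 : MemLp (fun x => f r x - f t x) 2 (volume : Measure ℝ) := m1.sub m2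
  have m5 : MemLp (fun x => (r - t) • f' t x) 2 (volume : Measure ℝ) := m3.const_smul (r - t)
  rw [← toL2_sub m1 m2, ← toL2_smul _ m3, ← toL2_sub m4 m5]
  have hbound : ∀ x, ‖f r x - f t x - (r - t) • f' t x‖ ≤ c / (√(2 * M) + 1) * |r - t| := by
    intro x
    have hconv : Convex ℝ (Icc 0 T ∩ Metric.ball t δ) := (convex_Icc 0 T).inter (convex_ball t δ)
    -- The mean value inequality for `f q x - q • f' t x` gives a remainder bound uniform in `x`.
    have := hconv.norm_image_sub_le_of_norm_hasDerivWithin_le (f := fun q => f q x - q • f' t x)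
      (f' := fun q => f' q x - (1 : ℝ) • f' t x) (C := c / (√(2 * M) + 1))
      (fun q hq => ((hd q hq.1 x).sub
        ((hasDerivWithinAt_id q _).smul_const (f' t x))).mono inter_subset_left)
      (fun q hq => by
        rw [one_smul]
        exact h q hq.1 (by rw [← Real.dist_eq]; exact hq.2) x)
      ⟨ht, Metric.mem_ball_self hδ⟩ ⟨hr, hrt⟩
    rw [Real.norm_eq_abs] at this
    refine le_trans (le_of_eq ?_) this
    congr 1
    rw [sub_smul]
    abel
  refine (norm_toL2_le hM0 ((hcr.sub hct).sub (hct'.const_smul (r - t)))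
    (fun x hx => by simp [hM r hr x hx, hM t ht x hx, hM' t ht x hx]) (by positivity)
    hbound).trans ?_
  rw [Real.norm_eq_abs]
  have : √(2 * M) * (c / (√(2 * M) + 1)) ≤ c := by
    rw [mul_div_assoc', div_le_iff₀ (by positivity)]
    nlinarith
  calc √(2 * M) * (c / (√(2 * M) + 1) * |r - t|)
      = √(2 * M) * (c / (√(2 * M) + 1)) * |r - t| := by ring
    _ ≤ c * |r - t| := by gcongr

theorem representsC1L2_toL2 (hT : 0 < T) (hM0 : 0 ≤ M)
    (hf : ContinuousOn (fun q : ℝ × ℝ => f q.1 q.2) (Icc 0 T ×ˢ univ))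
    (hf' : ContinuousOn (fun q : ℝ × ℝ => f' q.1 q.2) (Icc 0 T ×ˢ univ))
    (hM : ∀ t ∈ Icc 0 T, ∀ x, M ≤ |x| → f t x = 0)
    (hM' : ∀ t ∈ Icc 0 T, ∀ x, M ≤ |x| → f' t x = 0)
    (hd : ∀ t ∈ Icc 0 T, ∀ x, HasDerivWithinAt (fun r => f r x) (f' t x) (Icc 0 T) t) :
    RepresentsC1L2 T (fun t => toL2 (f t)) f where
  contDiffOn := by
    rw [contDiffOn_one_iff_derivWithin (uniqueDiffOn_Icc hT)]
    have hD := fun t ht => hasDerivWithinAt_toL2 hM0 hf hf' hM hM' hd (t := t) ht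
    exact ⟨fun t ht => (hD t ht).differentiableWithinAt, (continuousOn_toL2 hM0 hf' hM').congr
      fun t ht => (hD t ht).derivWithin (uniqueDiffOn_Icc hT t ht)⟩
  ae_eq t ht := coeFn_toL2 (memLp_two_of_vanish (continuousOn_slice hf ht) (hM t ht))

end Curve

/-! ### Properties of the regularised Heaviside function. -/

section Mollifier

variable {φ : ℝ → ℝ} {η : ℝ}

theorem continuous_rescale (hφ : IsMollifier φ) (η : ℝ) : Continuous (rescale φ η) :=
  continuous_const.mul (hφ.smooth.continuous.comp (continuous_id.div_const η))

theorem rescale_nonneg (hφ : IsMollifier φ) (hη : 0 < η) (t : ℝ) : 0 ≤ rescale φ η t :=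
  mul_nonneg (inv_nonneg.2 hη.le) (hφ.nonneg _)

theorem integral_rescale (hφ : IsMollifier φ) (hη : 0 < η) : ∫ t, rescale φ η t = 1 := by
  unfold rescale
  rw [integral_const_mul, Measure.integral_comp_div, hφ.integral_eq_one, abs_of_pos hη,
    smul_eq_mul, mul_one, inv_mul_cancel₀ hη.ne']

theorem integrable_rescale (hφ : IsMollifier φ) (hη : 0 < η) : Integrable (rescale φ η) := by
  -- A non-integrable function would have integral `0` by convention, not `1`.
  by_contra h
  have := integral_rescale hφ hη
  rw [integral_undef h] at this
  exact zero_ne_one this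

theorem IsMollifier.exists_radius (hφ : IsMollifier φ) :
    ∃ R > 0, ∀ t, R ≤ |t| → φ t = 0 := by
  obtain ⟨R, hR⟩ := hφ.compact.isCompact.isBounded.exists_norm_le
  refine ⟨max R 0 + 1, by positivity, fun t ht => ?_⟩
  by_contra h
  have h1 := hR t (subset_tsupport φ h)
  rw [Real.norm_eq_abs] at h1
  linarith [le_max_left R 0]

theorem rescale_eq_zero {R : ℝ} (hR : ∀ t, R ≤ |t| → φ t = 0) (hη : 0 < η) {t : ℝ}
    (ht : R * η ≤ |t|) : rescale φ η t = 0 := by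
  unfold rescale
  rw [hR, mul_zero]
  rwa [abs_div, abs_of_pos hη, le_div_iff₀ hη]

/-- For a mollifier and `η > 0` this is the distribution function of a probability density, whence
monotonicity, the bounds `0` and `1`, and the constant values outside the window. -/
theorem regHeaviside_eq (φ : ℝ → ℝ) (η t : ℝ) :
    regHeaviside φ η t = ∫ s in Iic t, rescale φ η s := by
  unfold regHeaviside
  rw [convolution_eq_swap, ← integral_indicator measurableSet_Iic]
  congr 1
  ext s
  by_cases h : s ≤ t <;> simp [heaviside, h]

theorem hasDerivAt_regHeaviside (hφ : IsMollifier φ) (hη : 0 < η) (t : ℝ) :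
    HasDerivAt (regHeaviside φ η) (rescale φ η t) t := by
  have h : regHeaviside φ η = fun t =>
      (∫ s in Iic 0, rescale φ η s) + ∫ s in (0 : ℝ)..t, rescale φ η s := by
    ext t
    have hi := integrable_rescale hφ hη
    rw [regHeaviside_eq, ← intervalIntegral.integral_Iic_sub_Iic hi.integrableOn hi.integrableOn]
    ring
  rw [h]
  exact (((continuous_rescale hφ η).integral_hasStrictDerivAt 0 t).hasDerivAt).const_add _

theorem regHeaviside_nonneg (hφ : IsMollifier φ) (hη : 0 < η) (t : ℝ) :
    0 ≤ regHeaviside φ η t := by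
  rw [regHeaviside_eq]
  exact integral_nonneg fun s => rescale_nonneg hφ hη s

theorem regHeaviside_le_one (hφ : IsMollifier φ) (hη : 0 < η) (t : ℝ) :
    regHeaviside φ η t ≤ 1 := by
  rw [regHeaviside_eq, ← integral_rescale hφ hη]
  exact setIntegral_le_integral (integrable_rescale hφ hη)
    (Eventually.of_forall fun s => rescale_nonneg hφ hη s)

theorem regHeaviside_eq_zero {R : ℝ} (hR : ∀ t, R ≤ |t| → φ t = 0) (hη : 0 < η) {t : ℝ}
    (ht : t ≤ -(R * η)) : regHeaviside φ η t = 0 := by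
  rw [regHeaviside_eq]
  refine setIntegral_eq_zero_of_forall_eq_zero fun s hs => rescale_eq_zero hR hη ?_
  exact le_trans (by linarith [mem_Iic.1 hs]) (neg_le_abs s)

theorem regHeaviside_eq_one (hφ : IsMollifier φ) {R : ℝ} (hR : ∀ t, R ≤ |t| → φ t = 0)
    (hη : 0 < η) {t : ℝ} (ht : R * η ≤ t) : regHeaviside φ η t = 1 := by
  rw [regHeaviside_eq, ← integral_rescale hφ hη]
  refine setIntegral_eq_integral_of_forall_compl_eq_zero fun s hs => rescale_eq_zero hR hη ?_
  have : t < s := not_le.1 hs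
  exact le_trans (by linarith) (le_abs_self s)

/-- The integrand vanishes before `1 - R η` and is at most `1` on the remaining interval, of length
at most `2 R η`. The assumption `R * η ≤ 1` keeps this window in nonnegative time. -/
theorem integral_regHeaviside_le (hφ : IsMollifier φ) {R : ℝ} (hR : ∀ t, R ≤ |t| → φ t = 0)
    (hη : 0 < η) (hRη : R * η ≤ 1) {t : ℝ} (ht0 : 0 ≤ t) (ht : t ≤ 1 + R * η) (hR0 : 0 < R) :
    ∫ r in (0 : ℝ)..t, regHeaviside φ η (r - 1) ≤ 2 * (R * η) := by
  have hc : Continuous (fun r => regHeaviside φ η (r - 1)) :=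
    (continuous_iff_continuousAt.2 fun t => (hasDerivAt_regHeaviside hφ hη t).continuousAt).comp
      (continuous_id.sub continuous_const)
  have hz : ∀ b ≤ 1 - R * η, 0 ≤ b → ∫ r in (0 : ℝ)..b, regHeaviside φ η (r - 1) = 0 := by
    intro b hb hb0
    rw [intervalIntegral.integral_congr (g := fun _ => (0 : ℝ)), intervalIntegral.integral_zero]
    intro r hr
    rw [uIcc_of_le hb0] at hr
    exact regHeaviside_eq_zero hR hη (by linarith [hr.2])
  have hp : 0 < R * η := mul_pos hR0 hη
  rcases le_total t (1 - R * η) with h | h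
  · rw [hz t h ht0]
    positivity
  · rw [← intervalIntegral.integral_add_adjacent_intervals (b := 1 - R * η)
      (hc.intervalIntegrable _ _) (hc.intervalIntegrable _ _), hz _ le_rfl (by linarith), zero_add]
    calc ∫ r in (1 - R * η)..t, regHeaviside φ η (r - 1) ≤ ∫ _r in (1 - R * η)..t, (1 : ℝ) :=
          intervalIntegral.integral_mono_on h (hc.intervalIntegrable _ _)
            intervalIntegrable_const fun r _ => regHeaviside_le_one hφ hη _
      _ ≤ 2 * (R * η) := by
          rw [intervalIntegral.integral_const, smul_eq_mul]
          linarith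

end Mollifier

/-! ### Explicit waves and regularity of the piecewise solution. -/

theorem hasDerivAt_comp_add_time {g g' : ℝ → ℂ} (hg : ∀ y, HasDerivAt g (g' y) y) (t x : ℝ) :
    HasDerivAt (fun r => g (x + r - 1)) (g' (x + t - 1)) t := by
  simpa [Function.comp_def] using
    (hg (x + t - 1)).scomp t (((hasDerivAt_id t).const_add x).sub_const 1)

theorem hasDerivAt_comp_sub_time {g g' : ℝ → ℂ} (hg : ∀ y, HasDerivAt g (g' y) y) (t x : ℝ) :
    HasDerivAt (fun r => g (x - r + 1)) (-g' (x - t + 1)) t := by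
  simpa [Function.comp_def] using
    (hg (x - t + 1)).scomp t (((hasDerivAt_id t).const_sub x).add_const 1)

/-- The jet of the travelling wave `A(x + t - 1) + B(x - t + 1)` with `A' = α`, `B' = β`. -/
theorem isWaveJet_travelling {α α' β β' : ℝ → ℂ} (hα : ∀ y, HasDerivAt α (α' y) y)
    (hβ : ∀ y, HasDerivAt β (β' y) y) (hα' : Continuous α') (hβ' : Continuous β') (s S : ℝ) :
    IsWaveJet s S (fun t x => α (x + t - 1) - β (x - t + 1))
      (fun t x => α (x + t - 1) + β (x - t + 1)) (fun t x => α' (x + t - 1) + β' (x - t + 1))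
      (fun t x => α' (x + t - 1) - β' (x - t + 1))
      (fun t x => α' (x + t - 1) + β' (x - t + 1)) := by
  have hαc : Continuous α := continuous_iff_continuousAt.2 fun t => (hα t).continuousAt
  have hβc : Continuous β := continuous_iff_continuousAt.2 fun t => (hβ t).continuousAt
  have at1 := fun t x => hasDerivAt_comp_add_time hα t x
  have bt1 := fun t x => hasDerivAt_comp_sub_time hβ t x
  have ax1 : ∀ t x, HasDerivAt (fun y => α (y + t - 1)) (α' (x + t - 1)) x := fun t x => by
    simpa [Function.comp_def] using
      (hα (x + t - 1)).scomp x (((hasDerivAt_id x).add_const t).sub_const 1)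
  have bx1 : ∀ t x, HasDerivAt (fun y => β (y - t + 1)) (β' (x - t + 1)) x := fun t x => by
    simpa [Function.comp_def] using
      (hβ (x - t + 1)).scomp x (((hasDerivAt_id x).sub_const t).add_const 1)
  exact
  { cont_t := by fun_prop
    cont_x := by fun_prop
    cont_tt := by fun_prop
    cont_tx := by fun_prop
    cont_xx := by fun_prop
    deriv_tt := fun t _ x => (((at1 t x).sub (bt1 t x)).congr_deriv (by ring)).hasDerivWithinAt
    deriv_xt := fun t _ x => (((at1 t x).add (bt1 t x)).congr_deriv (by ring)).hasDerivWithinAt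
    deriv_tx := fun t _ x => (ax1 t x).sub (bx1 t x)
    deriv_xx := fun t _ x => (ax1 t x).add (bx1 t x) }

/-- The jet of `g₀ + t g₁`. -/
theorem isWaveJet_affine {f f' g g' : ℝ → ℂ} (hf : ∀ y, HasDerivAt f (f' y) y)
    (hf' : Continuous f') {g₁ : ℝ → ℂ} (hg₁ : ∀ y, HasDerivAt g₁ (g y) y)
    (hg : ∀ y, HasDerivAt g (g' y) y) (hg' : Continuous g') (s S : ℝ) :
    IsWaveJet s S (fun _ x => g₁ x) (fun t x => f x + t * g x) (fun _ _ => 0) (fun _ x => g x)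
      (fun t x => f' x + t * g' x) := by
  have hfc : Continuous f := continuous_iff_continuousAt.2 fun t => (hf t).continuousAt
  have hgc : Continuous g := continuous_iff_continuousAt.2 fun t => (hg t).continuousAt
  have hg₁c : Continuous g₁ := continuous_iff_continuousAt.2 fun t => (hg₁ t).continuousAt
  exact
  { cont_t := by fun_prop
    cont_x := by fun_prop
    cont_tt := by fun_prop
    cont_tx := by fun_prop
    cont_xx := by fun_prop
    deriv_tt := fun t _ x => hasDerivWithinAt_const _ _ _
    deriv_xt := fun t _ x => by
      have h := ((Complex.ofRealCLM.hasDerivAt (x := t)).mul_const (g x)).const_add (f x)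
      simpa using h.hasDerivWithinAt
    deriv_tx := fun t _ x => hg₁ x
    deriv_xx := fun t _ x => (hf x).add ((hg x).const_mul _) }

/-- Derivative of the profile of the wave that travels to the left. -/
def leftProfile (g₀ g₁ : ℝ → ℂ) (y : ℝ) : ℂ := (deriv g₀ y + deriv g₁ y + g₁ y) / 2

/-- Derivative of the profile of the wave that travels to the right. -/
def rightProfile (g₀ g₁ : ℝ → ℂ) (y : ℝ) : ℂ := (deriv g₀ y + deriv g₁ y - g₁ y) / 2

/-- The time derivative of the piecewise distributional solution. -/
def piecewiseVelocity (g₀ g₁ : ℝ → ℂ) (t x : ℝ) : ℂ :=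
  leftProfile g₀ g₁ (x + max t 1 - 1) - rightProfile g₀ g₁ (x - max t 1 + 1)

section Piecewise

variable {g₀ g₁ : ℝ → ℂ}

theorem hasDerivAt_deriv_of_smooth {g : ℝ → ℂ} (hg : ContDiff ℝ ∞ g) (y : ℝ) :
    HasDerivAt g (deriv g y) y :=
  (hg.differentiable (by simp) y).hasDerivAt

theorem contDiff_deriv_of_smooth {g : ℝ → ℂ} (hg : ContDiff ℝ ∞ g) : ContDiff ℝ ∞ (deriv g) :=
  (contDiff_infty_iff_deriv.1 hg).2

theorem piecewiseVelocity_of_le {t : ℝ} (ht : t ≤ 1) (x : ℝ) :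
    piecewiseVelocity g₀ g₁ t x = g₁ x := by
  unfold piecewiseVelocity leftProfile rightProfile
  rw [max_eq_right ht, add_sub_cancel_right, sub_add_cancel]
  ring

theorem continuous_piecewiseVelocity (hg₀ : ContDiff ℝ ∞ g₀) (hg₁ : ContDiff ℝ ∞ g₁) :
    Continuous fun q : ℝ × ℝ => piecewiseVelocity g₀ g₁ q.1 q.2 := by
  have h0 := (contDiff_deriv_of_smooth hg₀).continuous
  have h1 := (contDiff_deriv_of_smooth hg₁).continuous
  have h2 := hg₁.continuous
  unfold piecewiseVelocity leftProfile rightProfile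
  fun_prop

theorem continuous_piecewiseSolution (hg₀ : ContDiff ℝ ∞ g₀) (hg₁ : ContDiff ℝ ∞ g₁) :
    Continuous fun q : ℝ × ℝ => piecewiseSolution g₀ g₁ q.1 q.2 := by
  have h0 := hg₀.continuous
  have h1 := hg₁.continuous
  have hI : Continuous fun y : ℝ => ∫ s in (0 : ℝ)..y, g₁ s :=
    intervalIntegral.continuous_primitive (fun a b => h1.intervalIntegrable a b) 0
  have hE : Continuous fun q : ℝ × ℝ => ∫ s in (q.2 - q.1 + 1)..(q.2 + q.1 - 1), g₁ s := by
    have : (fun q : ℝ × ℝ => ∫ s in (q.2 - q.1 + 1)..(q.2 + q.1 - 1), g₁ s)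
        = fun q => (∫ s in (0 : ℝ)..(q.2 + q.1 - 1), g₁ s)
          - ∫ s in (0 : ℝ)..(q.2 - q.1 + 1), g₁ s := by
      ext q
      exact (intervalIntegral.integral_interval_sub_left (h1.intervalIntegrable _ _)
        (h1.intervalIntegrable _ _)).symm
    rw [this]
    fun_prop
  have hif : (fun q : ℝ × ℝ => piecewiseSolution g₀ g₁ q.1 q.2)
      = fun q => if 1 ≤ q.1 then
        ((g₁ (q.2 + q.1 - 1) + g₁ (q.2 - q.1 + 1) + g₀ (q.2 + q.1 - 1) + g₀ (q.2 - q.1 + 1)) / 2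
          + (1 / 2) * ∫ s in (q.2 - q.1 + 1)..(q.2 + q.1 - 1), g₁ s)
        else g₀ q.2 + (q.1 : ℂ) * g₁ q.2 := by
    ext q
    unfold piecewiseSolution
    by_cases h : q.1 < 1
    · rw [if_pos h, if_neg (not_le.2 h)]
    · rw [if_neg h, if_pos (not_lt.1 h)]
  rw [hif]
  refine Continuous.if_le (by fun_prop) (by fun_prop) continuous_const continuous_fst ?_
  intro q hq
  rw [← hq]
  simp
  ring

/-- There is no jump in the derivative at `t = 1`, because d'Alembert's formula starts from the
value and the slope of `g₀ + t g₁` there. The derivative at `1` follows from continuity and the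
derivatives at all other times. -/
theorem hasDerivAt_piecewiseSolution (hg₀ : ContDiff ℝ ∞ g₀) (hg₁ : ContDiff ℝ ∞ g₁) (t x : ℝ) :
    HasDerivAt (fun r => piecewiseSolution g₀ g₁ r x) (piecewiseVelocity g₀ g₁ t x) t := by
  have hc := continuous_piecewiseSolution hg₀ hg₁
  have hv := continuous_piecewiseVelocity hg₀ hg₁
  have hne : ∀ t ≠ 1, HasDerivAt (fun r => piecewiseSolution g₀ g₁ r x)
      (piecewiseVelocity g₀ g₁ t x) t := by
    intro t ht
    rcases lt_or_gt_of_ne ht with h | h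
    · rw [piecewiseVelocity_of_le h.le]
      have h1 := ((Complex.ofRealCLM.hasDerivAt (x := t)).mul_const (g₁ x)).const_add (g₀ x)
      simp only [Complex.ofRealCLM_apply, Complex.ofReal_one, one_mul] at h1
      refine h1.congr_of_eventuallyEq ?_
      filter_upwards [Iio_mem_nhds h] with r hr
      exact if_pos hr
    · have hI : ∀ y, HasDerivAt (fun y => ∫ s in (0 : ℝ)..y, g₁ s) (g₁ y) y := fun y =>
        (hg₁.continuous.integral_hasStrictDerivAt 0 y).hasDerivAt
      have d0 := hasDerivAt_deriv_of_smooth hg₀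
      have d1 := hasDerivAt_deriv_of_smooth hg₁
      have key := (((((hasDerivAt_comp_add_time d1 t x).add (hasDerivAt_comp_sub_time d1 t x)).add
        (hasDerivAt_comp_add_time d0 t x)).add (hasDerivAt_comp_sub_time d0 t x)).div_const 2).add
        (((hasDerivAt_comp_add_time hI t x).sub (hasDerivAt_comp_sub_time hI t x)).const_mul (1 / 2))
      have e : piecewiseVelocity g₀ g₁ t x =
          (deriv g₁ (x + t - 1) + -deriv g₁ (x - t + 1) + deriv g₀ (x + t - 1)
            + -deriv g₀ (x - t + 1)) / 2 + 1 / 2 * (g₁ (x + t - 1) - -g₁ (x - t + 1)) := by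
        unfold piecewiseVelocity leftProfile rightProfile
        rw [max_eq_left h.le]
        ring
      rw [e]
      refine key.congr_of_eventuallyEq ?_
      filter_upwards [Ioi_mem_nhds h] with r hr
      have : ∫ s in (x - r + 1)..(x + r - 1), g₁ s
          = (∫ s in (0 : ℝ)..(x + r - 1), g₁ s) - ∫ s in (0 : ℝ)..(x - r + 1), g₁ s :=
        (intervalIntegral.integral_interval_sub_left (hg₁.continuous.intervalIntegrable _ _)
          (hg₁.continuous.intervalIntegrable _ _)).symm
      unfold piecewiseSolution
      rw [if_neg (not_lt.2 (le_of_lt (mem_Ioi.1 hr))), this]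
      rfl
  rcases eq_or_ne t 1 with rfl | ht
  · exact hasDerivAt_of_hasDerivAt_of_ne (f := fun r => piecewiseSolution g₀ g₁ r x)
      (g := fun r => piecewiseVelocity g₀ g₁ r x) hne
      (hc.comp (by fun_prop : Continuous fun r : ℝ => (r, x))).continuousAt
      (hv.comp (by fun_prop : Continuous fun r : ℝ => (r, x))).continuousAt
  · exact hne t ht

theorem exists_radius_data (hg₀ : HasCompactSupport g₀) (hg₁ : HasCompactSupport g₁) :
    ∃ M, 0 ≤ M ∧ ∀ y, M ≤ |y| → g₀ y = 0 ∧ g₁ y = 0 ∧ deriv g₀ y = 0 ∧ deriv g₁ y = 0 ∧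
      deriv (deriv g₀) y = 0 ∧ deriv (deriv g₁) y = 0 := by
  obtain ⟨R, hR⟩ := (hg₀.isCompact.union hg₁.isCompact).isBounded.exists_norm_le
  refine ⟨max R 0 + 1, by positivity, fun y hy => ?_⟩
  have h : y ∉ tsupport g₀ ∪ tsupport g₁ := fun h => by
    have h1 := hR y h
    rw [Real.norm_eq_abs] at h1
    linarith [le_max_left R 0]
  have n0 : y ∉ tsupport g₀ := fun h' => h (Or.inl h')
  have n1 : y ∉ tsupport g₁ := fun h' => h (Or.inr h')
  have d0 : y ∉ tsupport (deriv g₀) := fun h' => n0 (tsupport_deriv_subset h')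
  have d1 : y ∉ tsupport (deriv g₁) := fun h' => n1 (tsupport_deriv_subset h')
  exact ⟨image_eq_zero_of_notMem_tsupport n0, image_eq_zero_of_notMem_tsupport n1,
    image_eq_zero_of_notMem_tsupport d0, image_eq_zero_of_notMem_tsupport d1,
    image_eq_zero_of_notMem_tsupport fun h' => d0 (tsupport_deriv_subset h'),
    image_eq_zero_of_notMem_tsupport fun h' => d1 (tsupport_deriv_subset h')⟩

theorem le_abs_of_dist_le {M τ x y : ℝ} (hx : M + τ ≤ |x|) (hy : |x - y| ≤ τ) : M ≤ |y| := by
  have := abs_sub_abs_le_abs_sub x y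
  linarith

theorem piecewiseSolution_eq_zero {M T : ℝ} (h0 : ∀ y, M ≤ |y| → g₀ y = 0)
    (h1 : ∀ y, M ≤ |y| → g₁ y = 0) {t x : ℝ} (ht : t ∈ Icc 0 T) (hx : M + T ≤ |x|) :
    piecewiseSolution g₀ g₁ t x = 0 := by
  unfold piecewiseSolution
  split_ifs with h
  · have : M ≤ |x| := by linarith [ht.1, ht.2]
    rw [h0 x this, h1 x this]
    simp
  · have hn : ∀ y, |x - y| ≤ t - 1 → M ≤ |y| := fun y hy =>
      le_abs_of_dist_le hx (by linarith [ht.2])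
    have h' := not_lt.1 h
    have e1 : M ≤ |x + t - 1| := hn _ (by
      rw [show x - (x + t - 1) = -(t - 1) by ring, abs_neg, abs_of_nonneg (by linarith)])
    have e2 : M ≤ |x - t + 1| := hn _ (by
      rw [show x - (x - t + 1) = t - 1 by ring, abs_of_nonneg (by linarith)])
    have e3 : ∫ s in (x - t + 1)..(x + t - 1), g₁ s = 0 := by
      rw [intervalIntegral.integral_congr (g := fun _ => (0 : ℂ)), intervalIntegral.integral_zero]
      intro s hs
      rw [uIcc_of_le (by linarith)] at hs
      exact h1 s (hn s (abs_le.2 ⟨by linarith [hs.2], by linarith [hs.1]⟩))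
    rw [e3, h0 _ e1, h0 _ e2, h1 _ e1, h1 _ e2]
    simp

theorem piecewiseVelocity_eq_zero {M T : ℝ} (h1 : ∀ y, M ≤ |y| → g₁ y = 0)
    (h0' : ∀ y, M ≤ |y| → deriv g₀ y = 0) (h1' : ∀ y, M ≤ |y| → deriv g₁ y = 0) {t x : ℝ}
    (ht : t ∈ Icc 0 T) (hx : M + T ≤ |x|) : piecewiseVelocity g₀ g₁ t x = 0 := by
  have hτ : 0 ≤ max t 1 - 1 := by linarith [le_max_right t 1]
  have hτT : max t 1 - 1 ≤ T := by
    rw [sub_le_iff_le_add]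
    exact max_le (by linarith [ht.2]) (by linarith [ht.1, ht.2])
  have hn : ∀ y, |x - y| ≤ max t 1 - 1 → M ≤ |y| := fun y hy => le_abs_of_dist_le hx (by linarith)
  have e1 : M ≤ |x + max t 1 - 1| := hn _ (by
    rw [show x - (x + max t 1 - 1) = -(max t 1 - 1) by ring, abs_neg, abs_of_nonneg hτ])
  have e2 : M ≤ |x - max t 1 + 1| := hn _ (by
    rw [show x - (x - max t 1 + 1) = max t 1 - 1 by ring, abs_of_nonneg hτ])
  unfold piecewiseVelocity leftProfile rightProfile
  rw [h1 _ e1, h1 _ e2, h0' _ e1, h0' _ e2, h1' _ e1, h1' _ e2]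
  simp

end Piecewise

/-! ### Energy estimates at unit speed. -/

/-- The energy on `[-L,L]` of a wave of unit speed. -/
abbrev unitEnergy (L : ℝ) (wt wx : ℝ → ℝ → ℂ) (t : ℝ) : ℝ :=
  energy (-L) L (fun _ _ => 1) (fun _ => 1) wt wx t

theorem continuous_unitEnergyDensity {s S : ℝ} {wt wx wtt wtx wxx : ℝ → ℝ → ℂ}
    (hw : IsWaveJet s S wt wx wtt wtx wxx) {t : ℝ} (ht : t ∈ Icc s S) :
    Continuous fun x => 1 * energyDensity (fun _ => 1) wt wx t x :=
  continuous_const.mul (continuousOn_slice (continuousOn_energyDensity hw.cont_t hw.cont_x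
    (continuous_const (y := (1 : ℝ))) fun _ _ => one_pos) ht)

theorem integral_sq_le_unitEnergy {s S L : ℝ} (hL : 0 ≤ L) {wt wx wtt wtx wxx : ℝ → ℝ → ℂ}
    (hw : IsWaveJet s S wt wx wtt wtx wxx) {t : ℝ} (ht : t ∈ Icc s S) :
    ∫ x in (-L)..L, ‖wt t x‖ ^ 2 ≤ unitEnergy L wt wx t := by
  refine intervalIntegral.integral_mono_on (by linarith)
    (((continuousOn_slice hw.cont_t ht).norm.pow 2).intervalIntegrable _ _)
    ((continuous_unitEnergyDensity hw ht).intervalIntegrable _ _) fun x _ => ?_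
  simp only [energyDensity, div_one, one_mul]
  linarith [sq_nonneg ‖wx t x‖]

theorem norm_sub_sq_le (a b : ℂ) : ‖a - b‖ ^ 2 ≤ 2 * ‖a‖ ^ 2 + 2 * ‖b‖ ^ 2 := by
  have := norm_sub_le a b
  nlinarith [sq_nonneg (‖a‖ - ‖b‖), norm_nonneg (a - b), norm_nonneg a, norm_nonneg b]

theorem unitEnergy_sub_le {s S L : ℝ} (hL : 0 ≤ L)
    {wt wx wtt wtx wxx vt vx vtt vtx vxx : ℝ → ℝ → ℂ}
    (hw : IsWaveJet s S wt wx wtt wtx wxx) (hv : IsWaveJet s S vt vx vtt vtx vxx) {t : ℝ}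
    (ht : t ∈ Icc s S) :
    unitEnergy L (fun t x => wt t x - vt t x) (fun t x => wx t x - vx t x) t
      ≤ 2 * unitEnergy L wt wx t + 2 * unitEnergy L vt vx t := by
  have cw := continuous_unitEnergyDensity hw ht
  have cv := continuous_unitEnergyDensity hv ht
  simp only [unitEnergy, energy]
  rw [← intervalIntegral.integral_const_mul, ← intervalIntegral.integral_const_mul,
    ← intervalIntegral.integral_add ((cw.intervalIntegrable _ _).const_mul 2)
      ((cv.intervalIntegrable _ _).const_mul 2)]
  refine intervalIntegral.integral_mono_on (by linarith)
    ((continuous_unitEnergyDensity (hw.sub hv) ht).intervalIntegrable _ _)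
    (((cw.intervalIntegrable _ _).const_mul 2).add ((cv.intervalIntegrable _ _).const_mul 2))
    fun x _ => ?_
  simp only [energyDensity, div_one, one_mul]
  linarith [norm_sub_sq_le (wt t x) (vt t x), norm_sub_sq_le (wx t x) (vx t x)]

/-- Energy bound for a wave of unit speed with source `h`. -/
theorem unitEnergy_le_of_source {s S L H : ℝ} (hL : 0 ≤ L) {wt wx wtt wtx wxx h : ℝ → ℝ → ℂ}
    (hw : IsWaveJet s S wt wx wtt wtx wxx)
    (heq : ∀ t ∈ Icc s S, ∀ x, wtt t x = wxx t x + h t x)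
    (hl : ∀ t ∈ Icc s S, wt t (-L) = 0) (hm : ∀ t ∈ Icc s S, wt t L = 0)
    (hH : ∀ t ∈ Icc s S, ∀ x ∈ Icc (-L) L, ‖h t x‖ ^ 2 ≤ H) (hH0 : 0 ≤ H)
    {t : ℝ} (ht : t ∈ Icc s S) :
    unitEnergy L wt wx t ≤ Real.exp (t - s) * (unitEnergy L wt wx s + 2 * L * (H * (t - s))) := by
  have := energy_le (l := -L) (m := L) (by linarith) hw (isWeight_one s S) (c := fun _ => 1)
    (c' := fun _ => 0) (β := fun _ => H)
    (fun t => hasDerivAt_const t 1) continuous_const (fun _ _ => one_pos)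
    (fun _ _ => one_le_two) (fun _ _ => le_rfl) (fun t ht => by simp [hl t ht])
    (fun t ht => by simp [hm t ht]) continuous_const (fun _ _ => hH0)
    (fun t ht x hx => by
      rw [Complex.ofReal_one, div_one, div_one, one_mul, one_mul, heq t ht x, add_sub_cancel_left]
      have h1 := real_inner_le_norm (wt t x) (h t x)
      nlinarith [sq_nonneg (‖wt t x‖ - ‖h t x‖), hH t ht x hx]) ht
  rw [intervalIntegral.integral_const, smul_eq_mul] at this
  refine this.trans (le_of_eq ?_)
  simp only [unitEnergy]
  ring

/-! ### Comparison of the regularised and the piecewise solution. -/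

section Estimate

variable {g₀ g₁ : ℝ → ℂ} {T M L H : ℝ}

/-- The source `g₀'' + t g₁''` produced by subtracting `g₀ + t g₁`. -/
def affineSource (g₀ g₁ : ℝ → ℂ) (t x : ℝ) : ℂ := deriv (deriv g₀) x + t * deriv (deriv g₁) x

theorem continuous_affineSource (hg₀ : ContDiff ℝ ∞ g₀) (hg₁ : ContDiff ℝ ∞ g₁) :
    Continuous fun q : ℝ × ℝ => affineSource g₀ g₁ q.1 q.2 := by
  have h0 := (contDiff_deriv_of_smooth (contDiff_deriv_of_smooth hg₀)).continuous
  have h1 := (contDiff_deriv_of_smooth (contDiff_deriv_of_smooth hg₁)).continuous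
  unfold affineSource
  fun_prop

theorem isWaveJet_data (hg₀ : ContDiff ℝ ∞ g₀) (hg₁ : ContDiff ℝ ∞ g₁) (s S : ℝ) :
    IsWaveJet s S (fun _ x => g₁ x) (fun t x => deriv g₀ x + t * deriv g₁ x) (fun _ _ => 0)
      (fun _ x => deriv g₁ x) (affineSource g₀ g₁) :=
  isWaveJet_affine (hasDerivAt_deriv_of_smooth (contDiff_deriv_of_smooth hg₀))
    (contDiff_deriv_of_smooth (contDiff_deriv_of_smooth hg₀)).continuous
    (hasDerivAt_deriv_of_smooth hg₁) (hasDerivAt_deriv_of_smooth (contDiff_deriv_of_smooth hg₁))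
    (contDiff_deriv_of_smooth (contDiff_deriv_of_smooth hg₁)).continuous s S

/-- After time `1` the piecewise solution satisfies the wave equation, and the energy of its
difference to `g₀ + t g₁` grows at most linearly. -/
theorem exists_jet_piecewise (hg₀ : ContDiff ℝ ∞ g₀) (hg₁ : ContDiff ℝ ∞ g₁) (hL : 0 ≤ L)
    (hgL : ∀ x, L ≤ |x| → g₁ x = 0)
    (hvL : ∀ t ∈ Icc 0 T, ∀ x, L ≤ |x| → piecewiseVelocity g₀ g₁ t x = 0)
    (hH : ∀ t ∈ Icc 0 T, ∀ x ∈ Icc (-L) L, ‖affineSource g₀ g₁ t x‖ ^ 2 ≤ H) (hH0 : 0 ≤ H) :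
    ∃ vx vxx vtx : ℝ → ℝ → ℂ, IsWaveJet 1 T (piecewiseVelocity g₀ g₁) vx vxx vtx vxx ∧
      ∀ t ∈ Icc 1 T, unitEnergy L (fun t x => piecewiseVelocity g₀ g₁ t x - g₁ x)
        (fun t x => vx t x - (deriv g₀ x + t * deriv g₁ x)) t
          ≤ Real.exp T * (2 * L * H) * (t - 1) := by
  have s0 := contDiff_deriv_of_smooth hg₀
  have s1 := contDiff_deriv_of_smooth hg₁
  have d0 := hasDerivAt_deriv_of_smooth hg₀
  have d1 := hasDerivAt_deriv_of_smooth hg₁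
  have dd0 := hasDerivAt_deriv_of_smooth s0
  have dd1 := hasDerivAt_deriv_of_smooth s1
  have c0 := (contDiff_deriv_of_smooth s0).continuous
  have c1 := (contDiff_deriv_of_smooth s1).continuous
  have c1' := s1.continuous
  have J := isWaveJet_travelling (α := leftProfile g₀ g₁) (β := rightProfile g₀ g₁)
    (α' := fun y => (deriv (deriv g₀) y + deriv (deriv g₁) y + deriv g₁ y) / 2)
    (β' := fun y => (deriv (deriv g₀) y + deriv (deriv g₁) y - deriv g₁ y) / 2)
    (fun y => (((dd0 y).add (dd1 y)).add (d1 y)).div_const 2)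
    (fun y => (((dd0 y).add (dd1 y)).sub (d1 y)).div_const 2) (by fun_prop) (by fun_prop) 1 T
  have hvel : ∀ t ∈ Icc 1 T, ∀ x, leftProfile g₀ g₁ (x + t - 1) - rightProfile g₀ g₁ (x - t + 1)
      = piecewiseVelocity g₀ g₁ t x := fun t ht x => by
    unfold piecewiseVelocity
    rw [max_eq_left ht.1]
  have J' : IsWaveJet 1 T (piecewiseVelocity g₀ g₁) _ _ _ _ :=
    { J with
      cont_t := (continuous_piecewiseVelocity hg₀ hg₁).continuousOn
      deriv_tt := fun t ht x => (J.deriv_tt t ht x).congr (fun r hr => (hvel r hr x).symm)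
        (hvel t ht x).symm
      deriv_tx := fun t ht x => by
        have : piecewiseVelocity g₀ g₁ t = fun x =>
            leftProfile g₀ g₁ (x + t - 1) - rightProfile g₀ g₁ (x - t + 1) :=
          funext fun x => (hvel t ht x).symm
        rw [this]
        exact J.deriv_tx t ht x }
  refine ⟨_, _, _, J', fun t ht => ?_⟩
  have hsub : Icc 1 T ⊆ Icc 0 T := Icc_subset_Icc_left zero_le_one
  -- Subtracting `g₀ + t g₁` leaves a unit-speed wave with source `g₀'' + t g₁''` and zero energy at
  -- time `1`.
  have hE := unitEnergy_le_of_source (h := affineSource g₀ g₁) hL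
    (J'.sub (isWaveJet_data hg₀ hg₁ 1 T))
    (fun t ht x => by rw [sub_zero, sub_add_cancel])
    (fun t ht => by
      have : L ≤ |-L| := by rw [abs_neg]; exact le_abs_self L
      rw [hvL t (hsub ht) _ this, hgL _ this, sub_zero])
    (fun t ht => by rw [hvL t (hsub ht) _ (le_abs_self L), hgL _ (le_abs_self L), sub_zero])
    (fun t ht x hx => hH t (hsub ht) x hx) hH0 ht
  refine hE.trans ?_
  have h0 : unitEnergy L (fun t x => piecewiseVelocity g₀ g₁ t x - g₁ x)
      (fun t x => leftProfile g₀ g₁ (x + t - 1) + rightProfile g₀ g₁ (x - t + 1)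
        - (deriv g₀ x + t * deriv g₁ x)) 1 = 0 := by
    have e : ∀ x, leftProfile g₀ g₁ x + rightProfile g₀ g₁ x - (deriv g₀ x + deriv g₁ x) = 0 :=
      fun x => by
        unfold leftProfile rightProfile
        ring
    simp [unitEnergy, energy, energyDensity, piecewiseVelocity_of_le le_rfl, e]
  rw [h0, zero_add]
  have : Real.exp (t - 1) ≤ Real.exp T := Real.exp_le_exp.2 (by linarith [ht.2])
  have h1 : 0 ≤ t - 1 := by linarith [ht.1]
  calc Real.exp (t - 1) * (2 * L * (H * (t - 1))) ≤ Real.exp T * (2 * L * (H * (t - 1))) := by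
        gcongr
    _ = _ := by ring

/-- A coefficient of the regularised problem: `C¹`, nondecreasing, with values in `[0,1]`. -/
structure IsRegularCoefficient (a a' : ℝ → ℝ) : Prop where
  deriv : ∀ t, HasDerivAt a (a' t) t
  cont : Continuous a'
  deriv_nonneg : ∀ t, 0 ≤ a' t
  nonneg : ∀ t, 0 ≤ a t
  le_one : ∀ t, a t ≤ 1

theorem isRegularCoefficient_regHeaviside {φ : ℝ → ℝ} {η : ℝ} (hφ : IsMollifier φ) (hη : 0 < η) :
    IsRegularCoefficient (fun t => regHeaviside φ η (t - 1)) (fun t => rescale φ η (t - 1)) where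
  deriv t := by
    simpa [Function.comp_def] using
      (hasDerivAt_regHeaviside hφ hη (t - 1)).scomp t ((hasDerivAt_id t).sub_const 1)
  cont := (continuous_rescale hφ η).comp (by fun_prop)
  deriv_nonneg _ := rescale_nonneg hφ hη _
  nonneg _ := regHeaviside_nonneg hφ hη _
  le_one _ := regHeaviside_le_one hφ hη _

variable {a a' : ℝ → ℝ} {ut ux utt utx uxx : ℝ → ℝ → ℂ}

/-- Finite speed of propagation. -/
theorem velocity_eq_zero_of_far (hg₀ : ContDiff ℝ ∞ g₀) (hg₁ : ContDiff ℝ ∞ g₁)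
    (ha : IsRegularCoefficient a a') (hu : IsWaveJet 0 T ut ux utt utx uxx)
    (heq : ∀ t ∈ Icc 0 T, ∀ x, utt t x = a t * uxx t x) (h0 : ∀ x, ut 0 x = g₁ x)
    (hx0 : ∀ x, ux 0 x = deriv g₀ x) (hM1 : ∀ x, M ≤ |x| → g₁ x = 0)
    (hMs : ∀ t x, M ≤ |x| → affineSource g₀ g₁ t x = 0) (hL : M + 2 * T < L)
    {t : ℝ} (ht : t ∈ Icc 0 T) {x : ℝ} (hx : L ≤ |x|) : ut t x = 0 := by
  have hT : 0 ≤ T := ht.1.trans ht.2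
  -- The ball of radius `|x| - M` about `x` avoids `[-M,M]`, outside which the source vanishes; its
  -- radius exceeds `2 T` by the choice of `L`.
  have := deriv_eq_zero_of_cone (h := affineSource g₀ g₁) (r := |x| - M) (x₀ := x)
    (hu.sub (isWaveJet_data hg₀ hg₁ 0 T)) (by linarith) ha.deriv ha.cont ha.deriv_nonneg ha.nonneg
    ha.le_one (fun t ht x => by rw [sub_zero, sub_add_cancel]; exact heq t ht x)
    (continuous_affineSource hg₀ hg₁) (fun x => by rw [h0, sub_self])
    (fun x => by simp [hx0]) (fun t y hy => hMs t y (by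
      have h1 := abs_sub_abs_le_abs_sub x y
      rw [abs_sub_comm] at h1
      linarith)) ht
  rw [hM1 x (by linarith), sub_zero] at this
  exact this

/-- The quantitative comparison of a regularised solution with the piecewise solution, for a
coefficient that equals `1` from the time `1 + ρ` on. -/
theorem integral_velocity_sub_sq_le (hg₀ : ContDiff ℝ ∞ g₀) (hg₁ : ContDiff ℝ ∞ g₁) (hL : 0 ≤ L)
    (hgL : ∀ x, L ≤ |x| → g₁ x = 0)
    (hvL : ∀ t ∈ Icc 0 T, ∀ x, L ≤ |x| → piecewiseVelocity g₀ g₁ t x = 0)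
    (hH : ∀ t ∈ Icc 0 T, ∀ x ∈ Icc (-L) L, ‖affineSource g₀ g₁ t x‖ ^ 2 ≤ H) (hH0 : 0 ≤ H)
    (ha : IsRegularCoefficient a a') (hu : IsWaveJet 0 T ut ux utt utx uxx)
    (heq : ∀ t ∈ Icc 0 T, ∀ x, utt t x = a t * uxx t x) (h0 : ∀ x, ut 0 x = g₁ x)
    (hx0 : ∀ x, ux 0 x = deriv g₀ x) (huL : ∀ t ∈ Icc 0 T, ∀ x, L ≤ |x| → ut t x = 0)
    {ρ : ℝ} (hρ : 0 ≤ ρ) (hint : ∀ t, 0 ≤ t → t ≤ 1 + ρ → ∫ r in (0 : ℝ)..t, a r ≤ 2 * ρ)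
    (hone : ∀ t, 1 + ρ ≤ t → a t = 1) {t : ℝ} (ht : t ∈ Icc 0 T) :
    ∫ x in (-L)..L, ‖ut t x - piecewiseVelocity g₀ g₁ t x‖ ^ 2
      ≤ Real.exp T * (20 * Real.exp T * (2 * L * H)) * ρ := by
  have hT : 0 ≤ T := ht.1.trans ht.2
  have hneg : L ≤ |-L| := by rw [abs_neg]; exact le_abs_self L
  set K := Real.exp T * (2 * L * H) with hK
  have hK0 : 0 ≤ K := by positivity
  have hexp : 1 ≤ Real.exp T := Real.one_le_exp hT
  have Jw := hu.sub (isWaveJet_data hg₀ hg₁ 0 T)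
  have hw : ∀ t ∈ Icc 0 T, t ≤ 1 + ρ → unitEnergy L (fun t x => ut t x - g₁ x)
      (fun t x => ux t x - (deriv g₀ x + t * deriv g₁ x)) t ≤ 4 * K * ρ := by
    intro t ht htρ
    have hE := energy_le_of_degenerate (l := -L) (m := L) (h := affineSource g₀ g₁) (H := H)
      (by linarith) Jw (isWeight_one 0 T)
      ha.deriv ha.cont ha.deriv_nonneg ha.nonneg ha.le_one
      (fun t ht x => by rw [sub_zero, sub_add_cancel]; exact heq t ht x)
      (continuous_affineSource hg₀ hg₁) (fun x => by rw [h0, sub_self]) (fun x => by simp [hx0])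
      (fun t ht => by simp [huL t ht _ hneg, hgL _ hneg])
      (fun t ht => by simp [huL t ht _ (le_abs_self L), hgL _ (le_abs_self L)])
      (fun t ht x hx => by rw [one_mul]; exact hH t ht x hx) hH0 ht
    refine hE.trans ?_
    calc 2 * Real.exp T * (L - -L) * H * ∫ r in (0 : ℝ)..t, a r
        = 2 * K * ∫ r in (0 : ℝ)..t, a r := by rw [hK]; ring
      _ ≤ 2 * K * (2 * ρ) := by
          gcongr
          exact hint t ht.1 htρ
      _ = 4 * K * ρ := by ring
  have hKρ : 0 ≤ K * ρ := mul_nonneg hK0 hρ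
  -- The factor `20` is not sharp: the argument after time `1 + ρ` yields `10`.
  have hfinal : 10 * K * ρ ≤ Real.exp T * (20 * Real.exp T * (2 * L * H)) * ρ := by
    have : Real.exp T * (20 * Real.exp T * (2 * L * H)) * ρ = 20 * Real.exp T * (K * ρ) := by
      rw [hK]; ring
    rw [this]
    nlinarith
  rcases le_total t 1 with h1 | h1
  · simp only [piecewiseVelocity_of_le h1]
    have := (integral_sq_le_unitEnergy hL Jw ht).trans (hw t ht (by linarith))
    linarith
  obtain ⟨vx, vxx, vtx, Jv, hv⟩ := exists_jet_piecewise hg₀ hg₁ hL hgL hvL hH hH0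
  have hsub : Icc 1 T ⊆ Icc 0 T := Icc_subset_Icc_left zero_le_one
  have Jz := (hu.mono hsub).sub Jv
  -- Inside the window both functions are compared with `g₀ + t g₁`, and `10 = 2 · 4 + 2 · 1`.
  have hz : ∀ t ∈ Icc 1 T, t ≤ 1 + ρ →
      unitEnergy L (fun t x => ut t x - piecewiseVelocity g₀ g₁ t x)
        (fun t x => ux t x - vx t x) t ≤ 10 * K * ρ := by
    intro t ht htρ
    have e := unitEnergy_sub_le hL (Jw.mono hsub) (Jv.sub (isWaveJet_data hg₀ hg₁ 1 T)) ht
    simp only [sub_sub_sub_cancel_right] at e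
    have e1 := hw t (hsub ht) htρ
    have e2 := hv t ht
    have e3 : K * (t - 1) ≤ K * ρ := by
      gcongr
      linarith
    linarith
  rcases le_total t (1 + ρ) with h2 | h2
  · exact ((integral_sq_le_unitEnergy hL Jz ⟨h1, ht.2⟩).trans (hz t ⟨h1, ht.2⟩ h2)).trans hfinal
  · have hsub2 : Icc (1 + ρ) T ⊆ Icc 1 T := Icc_subset_Icc_left (by linarith)
    -- From `1 + ρ` on the difference solves the wave equation without source.
    have hE := unitEnergy_le_of_source (h := fun _ _ => 0) (H := 0) hL (Jz.mono hsub2)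
      (fun t ht x => by
        rw [heq t (hsub (hsub2 ht)) x, hone t ht.1, Complex.ofReal_one, one_mul, add_zero])
      (fun t ht => by
        rw [huL t (hsub (hsub2 ht)) _ hneg, hvL t (hsub (hsub2 ht)) _ hneg, sub_zero])
      (fun t ht => by
        rw [huL t (hsub (hsub2 ht)) _ (le_abs_self L), hvL t (hsub (hsub2 ht)) _ (le_abs_self L),
          sub_zero])
      (fun t ht x hx => by simp) le_rfl ⟨h2, ht.2⟩
    rw [zero_mul, mul_zero, add_zero] at hE
    refine ((integral_sq_le_unitEnergy hL Jz ⟨h1, ht.2⟩).trans hE).trans ?_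
    have e1 := hz (1 + ρ) ⟨by linarith, by linarith [ht.2]⟩ le_rfl
    calc _ ≤ Real.exp T * (10 * K * ρ) := by
          refine mul_le_mul (Real.exp_le_exp.2 (by linarith [ht.2])) e1 ?_ (Real.exp_pos _).le
          refine intervalIntegral.integral_nonneg (by linarith) fun x _ => ?_
          simp only [energyDensity]
          positivity
      _ ≤ _ := by
          rw [hK]
          have : 0 ≤ Real.exp T * (Real.exp T * (2 * L * H) * ρ) := by positivity
          linarith

end Estimate

/-! ### Passage to the limit. -/

theorem eq_zero_of_hasDerivWithinAt_zero {T : ℝ} {f f' : ℝ → ℂ}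
    (hd : ∀ t ∈ Icc 0 T, HasDerivWithinAt f (f' t) (Icc 0 T) t) (h' : ∀ t ∈ Icc 0 T, f' t = 0)
    (h0 : f 0 = 0) {t : ℝ} (ht : t ∈ Icc 0 T) : f t = 0 := by
  have := (convex_Icc 0 T).norm_image_sub_le_of_norm_hasDerivWithin_le (C := 0) hd
    (fun t ht => by rw [h' t ht, norm_zero]) (left_mem_Icc.2 (ht.1.trans ht.2)) ht
  rw [h0, sub_zero, zero_mul] at this
  exact norm_le_zero_iff.1 this

theorem convergesInC1L2_of_isVeryWeakSolution {T : ℝ} (hT : 0 < T) {g₀ g₁ : ℝ → ℂ}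
    (hg₀ : ContDiff ℝ ∞ g₀) (hg₀c : HasCompactSupport g₀)
    (hg₁ : ContDiff ℝ ∞ g₁) (hg₁c : HasCompactSupport g₁)
    {u : ℝ → ℝ → ℝ → ℂ} (hu : IsVeryWeakSolution T g₀ g₁ u) :
    ConvergesInC1L2 T u (piecewiseSolution g₀ g₁) := by
  obtain ⟨φ, hφ, κ, hκ, hsol⟩ := hu
  obtain ⟨M, hM0, hM⟩ := exists_radius_data hg₀c hg₁c
  obtain ⟨R, hR0, hR⟩ := hφ.exists_radius
  -- The cones have speed `2`, and the `1` makes the inequality for their radius strict; `M + T`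
  -- would suffice for the piecewise solution.
  set L := M + 2 * T + 1 with hLdef
  have hL : 0 ≤ L := by positivity
  obtain ⟨B, hB0, hB⟩ := exists_bound_of_continuousOn_strip (s := 0) (S := T) (-L) L
    (continuous_affineSource hg₀ hg₁).continuousOn
  have hH : ∀ t ∈ Icc 0 T, ∀ x ∈ Icc (-L) L, ‖affineSource g₀ g₁ t x‖ ^ 2 ≤ B ^ 2 :=
    fun t ht x hx => pow_le_pow_left₀ (norm_nonneg _) (hB t ht x hx) 2
  have hMs : ∀ t x, M ≤ |x| → affineSource g₀ g₁ t x = 0 := fun t x hx => by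
    obtain ⟨-, -, -, -, h0, h1⟩ := hM x hx
    simp [affineSource, h0, h1]
  have hgL : ∀ x, L ≤ |x| → g₁ x = 0 := fun x hx => (hM x (by linarith)).2.1
  have hvL : ∀ t ∈ Icc 0 T, ∀ x, L ≤ |x| → piecewiseVelocity g₀ g₁ t x = 0 := fun t ht x hx =>
    piecewiseVelocity_eq_zero (fun y hy => (hM y hy).2.1) (fun y hy => (hM y hy).2.2.1)
      (fun y hy => (hM y hy).2.2.2.1) ht (by linarith)
  have hsL : ∀ t ∈ Icc 0 T, ∀ x, L ≤ |x| → piecewiseSolution g₀ g₁ t x = 0 := fun t ht x hx =>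
    piecewiseSolution_eq_zero (fun y hy => (hM y hy).1) (fun y hy => (hM y hy).2.1) ht
      (by linarith)
  have hv := continuous_piecewiseVelocity hg₀ hg₁
  have hs := continuous_piecewiseSolution hg₀ hg₁
  have hsd : ∀ t ∈ Icc 0 T, ∀ x, HasDerivWithinAt (fun r => piecewiseSolution g₀ g₁ r x)
      (piecewiseVelocity g₀ g₁ t x) (Icc 0 T) t := fun t _ x =>
    (hasDerivAt_piecewiseSolution hg₀ hg₁ t x).hasDerivWithinAt
  have hVd := fun t ht =>
    hasDerivWithinAt_toL2 hL hs.continuousOn hv.continuousOn hsL hvL hsd (t := t) ht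
  set C := Real.exp T * (20 * Real.exp T * (2 * L * B ^ 2))
  have key : ∀ ε ∈ Ioc (0 : ℝ) 1, RepresentsC1L2 T (fun t => toL2 (u ε t)) (u ε) ∧
      ∃ W : ℝ → L2,
        (∀ t ∈ Icc 0 T, HasDerivWithinAt (fun t => toL2 (u ε t)) (W t) (Icc 0 T) t) ∧
        (R * κ ε ≤ 1 → ∀ t ∈ Icc 0 T,
          ‖W t - toL2 (piecewiseVelocity g₀ g₁ t)‖ ^ 2 ≤ C * (R * κ ε)) := by
    intro ε hε
    have hκε := hκ.pos ε hε
    have hsolε := hsol ε hε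
    obtain ⟨ut, ux, utt, utx, uxx, J, hut, heq, h0, hx0⟩ := hsolε.exists_jet hT
    have ha := isRegularCoefficient_regHeaviside hφ hκε
    have hutL : ∀ t ∈ Icc 0 T, ∀ x, L ≤ |x| → ut t x = 0 := fun t ht x hx =>
      velocity_eq_zero_of_far hg₀ hg₁ ha J heq h0 hx0 (fun y hy => (hM y hy).2.1) hMs
        (by linarith) ht hx
    have huL : ∀ t ∈ Icc 0 T, ∀ x, L ≤ |x| → u ε t x = 0 := fun t ht x hx =>
      eq_zero_of_hasDerivWithinAt_zero (f := fun t => u ε t x) (fun r hr => hut r hr x)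
        (fun r hr => hutL r hr x hx) (by rw [hsolε.initial, (hM x (by linarith)).1]) ht
    refine ⟨representsC1L2_toL2 hT hL hsolε.smooth.continuousOn J.cont_t huL hutL hut,
      fun t => toL2 (ut t), fun t ht =>
        hasDerivWithinAt_toL2 hL hsolε.smooth.continuousOn J.cont_t huL hutL hut ht, ?_⟩
    intro hRκ t ht
    have cu := continuousOn_slice J.cont_t ht
    have cv := continuousOn_slice (hv.continuousOn (s := Icc 0 T ×ˢ univ)) ht
    rw [← toL2_sub (memLp_two_of_vanish cu (hutL t ht)) (memLp_two_of_vanish cv (hvL t ht)),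
      norm_toL2_sq (M := L) (by fun_prop) fun x hx => by
        rw [hutL t ht x hx, hvL t ht x hx, sub_zero]]
    exact integral_velocity_sub_sq_le hg₀ hg₁ hL hgL hvL hH (by positivity) ha J heq h0 hx0 hutL
      (by positivity) (fun t ht0 ht1 => integral_regHeaviside_le hφ hR hκε hRκ ht0 ht1 hR0)
      (fun t ht => regHeaviside_eq_one hφ hR hκε (by linarith)) ht
  have small : ∀ η > 0, ∀ᶠ ε in 𝓝[>] (0 : ℝ), ε ∈ Ioc (0 : ℝ) 1 ∧ R * κ ε ≤ 1 ∧
      C * (R * κ ε) ≤ η ^ 2 := by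
    intro η hη
    have h1 : Tendsto (fun ε => R * κ ε) (𝓝[>] 0) (𝓝 0) := by
      simpa using hκ.tendsto.const_mul R
    have h2 : Tendsto (fun ε => C * (R * κ ε)) (𝓝[>] 0) (𝓝 0) := by
      simpa using h1.const_mul C
    filter_upwards [Ioc_mem_nhdsGT one_pos, h1.eventually_le_const one_pos,
      h2.eventually_le_const (pow_pos hη 2)] with ε a b c using ⟨a, b, c⟩
  refine ⟨fun ε t => toL2 (u ε t), fun t => toL2 (piecewiseSolution g₀ g₁ t),
    fun ε hε => (key ε hε).1,
    representsC1L2_toL2 hT hL hs.continuousOn hv.continuousOn hsL hvL hsd, ?_, ?_⟩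
  · rw [Metric.tendstoUniformlyOn_iff]
    intro η hη
    have hη' : 0 < η / (T + 1) := by positivity
    filter_upwards [small _ hη'] with ε hε t ht
    obtain ⟨-, W, hW, hWle⟩ := key ε hε.1
    have h00 : toL2 (u ε 0) - toL2 (piecewiseSolution g₀ g₁ 0) = 0 := by
      have e : u ε 0 = piecewiseSolution g₀ g₁ 0 := by
        ext x
        rw [(hsol ε hε.1).initial]
        simp [piecewiseSolution]
      rw [e, sub_self]
    -- The mean value inequality in `L²`, from the common initial value `g₀`; velocities within `η /
    -- (T + 1)` keep the functions strictly within `η`.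
    have := (convex_Icc 0 T).norm_image_sub_le_of_norm_hasDerivWithin_le
      (f := fun t => toL2 (u ε t) - toL2 (piecewiseSolution g₀ g₁ t)) (C := η / (T + 1))
      (fun r hr => (hW r hr).sub (hVd r hr))
      (fun r hr => abs_le_of_sq_le_sq' ((hWle hε.2.1 r hr).trans hε.2.2) hη'.le |>.2)
      (left_mem_Icc.2 hT.le) ht
    simp only [h00, sub_zero] at this
    rw [dist_comm, dist_eq_norm]
    refine this.trans_lt ?_
    rw [Real.norm_of_nonneg ht.1, div_mul_eq_mul_div, div_lt_iff₀ (by positivity)]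
    nlinarith [ht.2]
  · rw [Metric.tendstoUniformlyOn_iff]
    intro η hη
    have hη' : 0 < η / 2 := by positivity
    filter_upwards [small _ hη'] with ε hε t ht
    obtain ⟨-, W, hW, hWle⟩ := key ε hε.1
    have hUt := uniqueDiffOn_Icc hT t ht
    rw [(hVd t ht).derivWithin hUt, (hW t ht).derivWithin hUt, dist_comm, dist_eq_norm]
    have := abs_le_of_sq_le_sq' ((hWle hε.2.1 t ht).trans hε.2.2) hη'.le |>.2
    linarith

end HeavisideWave

end

theorem mainTheorem6 (T : ℝ) (hT : 0 < T) (g₀ g₁ : ℝ → ℂ)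
    (hg₀ : ContDiff ℝ ∞ g₀) (hg₀c : HasCompactSupport g₀)
    (hg₁ : ContDiff ℝ ∞ g₁) (hg₁c : HasCompactSupport g₁)
    (u : ℝ → ℝ → ℝ → ℂ) (hu : HeavisideWave.IsVeryWeakSolution T g₀ g₁ u) :
    HeavisideWave.ConvergesInC1L2 T u (HeavisideWave.piecewiseSolution g₀ g₁) :=
  HeavisideWave.convergesInC1L2_of_isVeryWeakSolution hT hg₀ hg₀c hg₁ hg₁c hu
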